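/- Let $C$ be a small category, $\widehat C=\mathrm{Set}^{C^{op}}$, and let $T$ be a familial monad on $\widehat C$: a cartesian monad with functor part $(TX)_c=\coprod_{t\in T(1)_c}\mathrm{Hom}(T[t],X)$ for a presheaf $T(1)$ on $C$ and a functor $T[-]:\int T(1)\to\widehat C$. *Multicategories.* For a monad $S$ on a category with pullbacks, an $S$-multicategory is a span $SV_0\xleftarrow{dom}V_1\xrightarrow{cod}V_0$ with identities $V_0\to V_1$ and composition $SV_1\times_{SV_0}V_1\to V_1$ satisfying the unit and associativity laws; an $S$-multifunctor is a map of spans compatible with identities and composition. For an $S$-algebra $h:SA\to A$, $M A$ is the discrete $S$-multicategory with span $SA\xleftarrow{1}SA\xrightarrow{h}A$. For an object $A$ (in a category which also has binary products), $\mathrm{Ind}(A)$ is the indiscrete $S$-multicategory with span $SA\xleftarrow{\pi_1}SA\times A\xrightarrow{\pi_2}A$. *The category $C^+$ and the monad $T^+$.* The objects of $C^+$ are those of $C$ and those of $\int T(1)$; its maps are those of $C$, those of $\int T(1)$, and, from $d\in C$ to an operation $t\in T(1)_c$, the elements of $C(d,c)\sqcup T[t]_d$ (target faces and source cells). A $T$-graph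 $TX_0\xleftarrow{}X_1\to X_0$ is regarded as a presheaf on $C^+$, with $c$-cells the elements of $(X_0)_c$ and with $t$-arrows the elements of $(X_1)_c$ whose domain is of the form $(t,\,T[t]\to X_0)$. The forgetful functor from $T$-multicategories to $\widehat{C^+}$ has a left adjoint, and $T^+$ is the monad of this adjunction (the free $T$-multicategory monad); every $T$-multicategory has an underlying $T^+$-algebra. *Enrichment.* Let $u:D\to C'$ be a restriction of cell shapes (the inclusion of a full subcategory containing the source of every map into one of its objects), with adjoints $u_!\dashv u^*\dashv u_*$, where $(u_*X)_c=\mathrm{Hom}(u^*y(c),X)$, and let $S$ be a $D$-graded monad on $\widehat{C'}$, that is, $u^*S(u_!u^*X\to X)$ is invertible for all $X$ (for familial $S$: the arities of the operations over objects of $D$ are of the form $u_!Y$). Let $S_D=u^*Su_!$ be the transport of $S$ along $u_!\dashv u^*$. Then $u_*$ lifts to a functor from $S_D$-algebras to $S$-algebras, where the structure map of $u_*Y$ is the transpose of $u^*Su_*Y\cong S_Du^*u_*Y\to S_DY\to Y$. For an $S$-multicategory $V$, a $(V,D)$-enriched $S$-algebra is an $S_D$-algebra $A$ with an $S$-multifunctor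 $M u_*A\to V$. The inclusion $u:C\to C^+$ is a restriction of cell shapes for which $T^+$ is $C$-graded. For a $T^+$-multicategory $V$, a $V$-enriched $T$-multicategory in the sense of Leinster is a presheaf $A$ on $C$ with a $T^+$-multifunctor $M\,\mathrm{Ind}(A)\to V$, where $\mathrm{Ind}(A)$ is the indiscrete $T$-multicategory on $A$, regarded as a $T^+$-algebra. **Theorem.** Every presheaf $A$ on $C$ carries a unique $(T^+)_C$-algebra structure. There is an isomorphism of $T^+$-algebras $\varphi_A:u_*A\cong\mathrm{Ind}(A)$, natural in the $(T^+)_C$-algebra $A$, which on the cells of $C$ is the canonical identification $(u_*A)_c=\mathrm{Hom}(u^*y(c),A)\cong A_c$, $x\mapsto x(1_c)$. Consequently, for every $T^+$-multicategory $V$, the assignment $$(A,\;H:M u_*A\to V)\;\longmapsto\;(A,\;H\circ M\varphi_A^{-1}:M\,\mathrm{Ind}(A)\to V)$$ is a bijection from the $(V,C)$-enriched $T^+$-algebras to Leinster's $V$-enriched $T$-multicategories. -/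

import Mathlib

universe v u

open CategoryTheory CategoryTheory.Limits Opposite

namespace EnrichedAlgebras

section Multicategories

variable {E : Type u} [Category.{v} E]

/-- A `T`-graph: a span `T X₀ ⟵ X₁ ⟶ X₀`. -/
structure TGraph (T : Monad E) where
  cells : E
  arrows : E
  dom : arrows ⟶ T.obj cells
  cod : arrows ⟶ cells

/-- A map of `T`-graphs: a map of spans whose left leg is in the image of `T`. -/
@[ext]
structure TGraph.Hom {T : Monad E} (G H : TGraph T) where
  onCells : G.cells ⟶ H.cells
  onArrows : G.arrows ⟶ H.arrows
  dom_comm : onArrows ≫ H.dom = G.dom ≫ T.map onCells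
  cod_comm : onArrows ≫ H.cod = G.cod ≫ onCells

instance (T : Monad E) : Category (TGraph T) where
  Hom := TGraph.Hom
  id G := ⟨𝟙 _, 𝟙 _, by simp, by simp⟩
  comp f g := ⟨f.onCells ≫ g.onCells, f.onArrows ≫ g.onArrows,
    by simp [g.dom_comm, reassoc_of% f.dom_comm], by simp [g.cod_comm, reassoc_of% f.cod_comm]⟩

variable [HasPullbacks E]

/-- A `T`-multicategory: a `T`-graph with identities and with the composition of an arrow `q` with
an arrangement `p` of arrows whose codomains form the domain of `q`. -/
structure Multicat (T : Monad E) extends TGraph T where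
  ids : cells ⟶ arrows
  ids_dom : ids ≫ dom = T.η.app cells
  ids_cod : ids ≫ cod = 𝟙 cells
  comp : pullback (T.map cod) dom ⟶ arrows
  comp_dom : comp ≫ dom = pullback.fst _ _ ≫ T.map dom ≫ T.μ.app cells
  comp_cod : comp ≫ cod = pullback.snd _ _ ≫ cod
  /-- composing an arrow with the identities of the cells in its domain -/
  ids_comp : pullback.lift (dom ≫ T.map ids) (𝟙 arrows)
    (by rw [Category.assoc, ← T.map_comp, ids_cod]; simp) ≫ comp = 𝟙 arrows
  /-- composing the identity of the codomain of an arrow with that arrow -/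
  comp_ids : pullback.lift (T.η.app arrows) (cod ≫ ids)
    (by rw [Category.assoc, ids_dom]; exact (T.η.naturality cod).symm) ≫ comp = 𝟙 arrows
  /-- associativity, on towers consisting of an arrow, an arrangement of arrows over its domain,
  and for each of these an arrangement of arrows over its domain -/
  comp_assoc :
    pullback.lift
      (pullback.fst (T.map (pullback.snd (T.map cod) dom ≫ cod)) dom ≫ T.map comp)
      (pullback.snd (T.map (pullback.snd (T.map cod) dom ≫ cod)) dom)
      (by rw [Category.assoc, ← T.map_comp, comp_cod, pullback.condition]) ≫ comp =
    pullback.lift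
      (pullback.fst (T.map (pullback.snd (T.map cod) dom ≫ cod)) dom ≫
        T.map (pullback.fst (T.map cod) dom) ≫ T.μ.app arrows)
      (pullback.lift
        (pullback.fst (T.map (pullback.snd (T.map cod) dom ≫ cod)) dom ≫
          T.map (pullback.snd (T.map cod) dom))
        (pullback.snd (T.map (pullback.snd (T.map cod) dom ≫ cod)) dom)
        (by rw [Category.assoc, ← T.map_comp, pullback.condition]) ≫ comp)
      (by
        have h := T.μ.naturality cod
        dsimp at h
        simp only [Category.assoc, comp_dom, pullback.lift_fst_assoc]
        rw [← h, ← T.map_comp_assoc, ← T.map_comp_assoc, pullback.condition]) ≫ comp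

/-- The map of composable pairs of arrows induced by a map of `T`-graphs. -/
noncomputable def TGraph.Hom.onPairs {T : Monad E} {G H : TGraph T} (f : G.Hom H) :
    pullback (T.map G.cod) G.dom ⟶ pullback (T.map H.cod) H.dom :=
  pullback.map _ _ _ _ (T.map f.onArrows) f.onArrows (T.map f.onCells)
    (by rw [← T.map_comp, ← T.map_comp, f.cod_comm]) f.dom_comm.symm

/-- A `T`-multifunctor: a map of the underlying `T`-graphs that commutes with identities and
composites. -/
@[ext]
structure Multicat.Hom {T : Monad E} (V W : Multicat T) extends
    TGraph.Hom V.toTGraph W.toTGraph where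
  map_ids : V.ids ≫ onArrows = onCells ≫ W.ids
  map_comp : V.comp ≫ onArrows = toHom.onPairs ≫ W.comp

instance (T : Monad E) : Category (Multicat T) where
  Hom := Multicat.Hom
  id V :=
    { toHom := 𝟙 V.toTGraph
      map_ids := (Category.comp_id _).trans (Category.id_comp _).symm
      map_comp := by
        have : TGraph.Hom.onPairs (𝟙 V.toTGraph) = 𝟙 _ := by
          apply pullback.hom_ext
          · simp only [TGraph.Hom.onPairs, pullback.map, pullback.lift_fst]
            erw [T.map_id]; simp
          · simp only [TGraph.Hom.onPairs, pullback.map, pullback.lift_snd]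
            exact (Category.comp_id _).trans (Category.id_comp _).symm
        rw [this]
        exact (Category.comp_id _).trans (Category.id_comp _).symm }
  comp {U V W} f g :=
    { toHom := CategoryStruct.comp (obj := TGraph T) f.toHom g.toHom
      map_ids := by
        change U.ids ≫ f.onArrows ≫ g.onArrows = (f.onCells ≫ g.onCells) ≫ W.ids
        rw [reassoc_of% f.map_ids, g.map_ids, Category.assoc]
      map_comp := by
        have : TGraph.Hom.onPairs (CategoryStruct.comp (obj := TGraph T) f.toHom g.toHom) =
            f.toHom.onPairs ≫ g.toHom.onPairs := by
          apply pullback.hom_ext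
          · simp only [TGraph.Hom.onPairs, pullback.map, pullback.lift_fst, Category.assoc,
              pullback.lift_fst_assoc]
            rw [← T.map_comp]; rfl
          · simp only [TGraph.Hom.onPairs, pullback.map, pullback.lift_snd, Category.assoc,
              pullback.lift_snd_assoc]
            rfl
        rw [this, Category.assoc, ← g.map_comp, ← reassoc_of% f.map_comp]
        rfl }

/-- The underlying `T`-graph of a `T`-multicategory. -/
def Multicat.graph (T : Monad E) : Multicat T ⥤ TGraph T where
  obj V := V.toTGraph
  map f := f.toHom

theorem Multicat.hom_ext {T : Monad E} {V W : Multicat T} {f g : V ⟶ W}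
    (h₀ : f.onCells = g.onCells) (h₁ : f.onArrows = g.onArrows) : f = g :=
  Multicat.Hom.ext h₀ h₁

/-- The discrete `T`-multicategory `M A` of a `T`-algebra `h : T A ⟶ A`, with span
`T A ⟵ T A ⟶ A` given by the identity and `h`. -/
noncomputable def discreteObj (T : Monad E) (A : T.Algebra) : Multicat T where
  cells := A.A
  arrows := T.obj A.A
  dom := 𝟙 _
  cod := A.a
  ids := T.η.app A.A
  ids_dom := Category.comp_id _
  ids_cod := A.unit
  comp := pullback.fst _ _ ≫ T.μ.app A.A
  comp_dom := by simp
  comp_cod := by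
    rw [Category.assoc, A.assoc, pullback.condition_assoc]; simp
  ids_comp := by
    rw [pullback.lift_fst_assoc, Category.id_comp]; exact T.right_unit _
  comp_ids := by
    rw [pullback.lift_fst_assoc]; exact T.left_unit _
  comp_assoc := by
    simp only [pullback.lift_fst_assoc, Category.assoc, T.map_comp, T.assoc]

theorem onPairs_fst {T : Monad E} {G H : TGraph T} (f : G.Hom H) :
    f.onPairs ≫ pullback.fst _ _ = pullback.fst _ _ ≫ T.map f.onArrows :=
  pullback.lift_fst _ _ _

theorem onPairs_snd {T : Monad E} {G H : TGraph T} (f : G.Hom H) :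
    f.onPairs ≫ pullback.snd _ _ = pullback.snd _ _ ≫ f.onArrows :=
  pullback.lift_snd _ _ _

/-- The construction `M` as a functor. -/
noncomputable def discrete (T : Monad E) : T.Algebra ⥤ Multicat T where
  obj A := discreteObj T A
  map {A B} f :=
    { onCells := f.f
      onArrows := T.map f.f
      dom_comm := (Category.comp_id _).trans (Category.id_comp _).symm
      cod_comm := f.h
      map_ids := (T.η.naturality f.f).symm
      map_comp := by
        dsimp only [discreteObj]
        rw [← Category.assoc, onPairs_fst, Category.assoc, Category.assoc]
        congr 1
        exact (T.μ.naturality f.f).symm }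
  map_id A := Multicat.hom_ext rfl (T.map_id _)
  map_comp f g := Multicat.hom_ext rfl (T.map_comp _ _)

/-- On a `T`-graph whose arrows are determined by their domain and codomain, the laws of a
`T`-multicategory are automatic. -/
noncomputable def Multicat.ofThin {T : Monad E} (G : TGraph T)
    (thin : ∀ {Z : E} (f g : Z ⟶ G.arrows), f ≫ G.dom = g ≫ G.dom → f ≫ G.cod = g ≫ G.cod → f = g)
    (ids : G.cells ⟶ G.arrows) (ids_dom : ids ≫ G.dom = T.η.app G.cells)
    (ids_cod : ids ≫ G.cod = 𝟙 G.cells)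
    (comp : pullback (T.map G.cod) G.dom ⟶ G.arrows)
    (comp_dom : comp ≫ G.dom = pullback.fst _ _ ≫ T.map G.dom ≫ T.μ.app G.cells)
    (comp_cod : comp ≫ G.cod = pullback.snd _ _ ≫ G.cod) : Multicat T where
  toTGraph := G
  ids := ids
  ids_dom := ids_dom
  ids_cod := ids_cod
  comp := comp
  comp_dom := comp_dom
  comp_cod := comp_cod
  ids_comp := by
    apply thin
    · rw [Category.assoc, comp_dom, pullback.lift_fst_assoc, Category.assoc,
        ← T.map_comp_assoc, ids_dom, Category.id_comp]
      exact (congrArg (_ ≫ ·) (T.right_unit _)).trans (Category.comp_id _)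
    · rw [Category.assoc, comp_cod, pullback.lift_snd_assoc]
  comp_ids := by
    apply thin
    · have h := T.η.naturality G.dom
      dsimp at h
      rw [Category.assoc, comp_dom, pullback.lift_fst_assoc, ← reassoc_of% h]
      exact (congrArg (_ ≫ ·) (T.left_unit _)).trans
        ((Category.comp_id _).trans (Category.id_comp _).symm)
    · rw [Category.assoc, comp_cod, pullback.lift_snd_assoc, Category.assoc, ids_cod]
      exact (Category.comp_id _).trans (Category.id_comp _).symm
  comp_assoc := by
    apply thin
    · have h := T.μ.naturality G.dom
      dsimp at h
      simp only [Category.assoc, comp_dom, pullback.lift_fst_assoc]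
      rw [← T.map_comp_assoc, comp_dom, ← reassoc_of% h, T.map_comp_assoc, T.map_comp_assoc,
        T.assoc]
    · simp only [Category.assoc, comp_cod, pullback.lift_snd_assoc]

/-- The indiscrete `T`-multicategory on `A`, with span `T A ⟵ T A × A ⟶ A` given by the
projections. -/
noncomputable def indiscreteObj [HasBinaryProducts E] (T : Monad E) (A : E) : Multicat T :=
  Multicat.ofThin
    { cells := A
      arrows := T.obj A ⨯ A
      dom := prod.fst
      cod := prod.snd }
    (fun _ _ => Limits.prod.hom_ext)
    (prod.lift (T.η.app A) (𝟙 A)) (prod.lift_fst _ _) (prod.lift_snd _ _)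
    (prod.lift (pullback.fst _ _ ≫ T.map prod.fst ≫ T.μ.app A) (pullback.snd _ _ ≫ prod.snd))
    (prod.lift_fst _ _) (prod.lift_snd _ _)

/-- A map of `T`-graphs into a `T`-multicategory whose arrows are determined by their domain and
codomain is automatically a `T`-multifunctor. -/
noncomputable def Multicat.homOfThin {T : Monad E} {V W : Multicat T}
    (thin : ∀ {Z : E} (f g : Z ⟶ W.arrows), f ≫ W.dom = g ≫ W.dom → f ≫ W.cod = g ≫ W.cod → f = g)
    (f : V.toTGraph ⟶ W.toTGraph) : V ⟶ W :=
  { toHom := f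
    map_ids := by
      have h := T.η.naturality f.onCells
      dsimp at h
      apply thin
      · rw [Category.assoc, Category.assoc, f.dom_comm, W.ids_dom, ← Category.assoc, V.ids_dom, h]
      · rw [Category.assoc, Category.assoc, f.cod_comm, W.ids_cod, ← Category.assoc, V.ids_cod,
          Category.comp_id, Category.id_comp]
    map_comp := by
      have h := T.μ.naturality f.onCells
      dsimp at h
      apply thin
      · rw [Category.assoc, Category.assoc, f.dom_comm, W.comp_dom, ← Category.assoc, V.comp_dom,
          ← Category.assoc (TGraph.Hom.onPairs _), onPairs_fst, Category.assoc, Category.assoc,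
          Category.assoc, ← T.map_comp_assoc, f.dom_comm, ← h, T.map_comp_assoc]
      · rw [Category.assoc, Category.assoc, f.cod_comm, W.comp_cod, ← Category.assoc, V.comp_cod,
          ← Category.assoc (TGraph.Hom.onPairs _), onPairs_snd, Category.assoc, Category.assoc,
          f.cod_comm] }

/-- The indiscrete `T`-multicategory as a functor. -/
noncomputable def indiscrete [HasBinaryProducts E] (T : Monad E) : E ⥤ Multicat T where
  obj A := indiscreteObj T A
  map f := Multicat.homOfThin (fun _ _ => Limits.prod.hom_ext)
    { onCells := f
      onArrows := Limits.prod.map (T.map f) f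
      dom_comm := Limits.prod.map_fst _ _
      cod_comm := Limits.prod.map_snd _ _ }
  map_id _ := Multicat.hom_ext rfl ((congrArg (Limits.prod.map · _) (T.map_id _)).trans
    Limits.prod.map_id_id)
  map_comp f g := Multicat.hom_ext rfl
    ((congrArg (Limits.prod.map · _) (T.map_comp f g)).trans
      (Limits.prod.map_map (T.map f) f (T.map g) g).symm)

end Multicategories

section Familial

variable {C : Type u} [SmallCategory C]

theorem familial_ext {ops : Cᵒᵖ ⥤ Type u} {arity : ops.Elementsᵒᵖ ⥤ Cᵒᵖ ⥤ Type u}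
    {X : Cᵒᵖ ⥤ Type u} {c : Cᵒᵖ} {t t' : ops.obj c}
    {a : arity.obj (op (ops.elementsMk c t)) ⟶ X} {a' : arity.obj (op (ops.elementsMk c t')) ⟶ X}
    (k : ops.elementsMk c t ⟶ ops.elementsMk c t') (hk : k.1 = 𝟙 c)
    (h : a' = arity.map k.op ≫ a) :
    (⟨t', a'⟩ : Σ t : ops.obj c, arity.obj (op (ops.elementsMk c t)) ⟶ X) = ⟨t, a⟩ := by
  obtain ⟨i, hi⟩ := k
  change i = 𝟙 c at hk
  subst hk h
  have ht : t = t' := by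
    have h' : ops.map (𝟙 c) t = t' := hi
    simpa using h'
  subst ht
  have : (⟨𝟙 c, hi⟩ : ops.elementsMk c t ⟶ ops.elementsMk c t) = 𝟙 (ops.elementsMk c t) := rfl
  rw [this]
  simp

theorem arity_comp {ops : Cᵒᵖ ⥤ Type u} (arity : ops.Elementsᵒᵖ ⥤ Cᵒᵖ ⥤ Type u)
    {X : Cᵒᵖ ⥤ Type u} {c c' c'' : Cᵒᵖ} (i : c ⟶ c') (j : c' ⟶ c'') {t : ops.obj c}
    {t₂ : ops.obj c'} {t₃ t₄ : ops.obj c''} (h₂ : ops.map i t = t₂) (h₃ : ops.map j t₂ = t₃)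
    (h₄ : ops.map (𝟙 c'') t₃ = t₄) (h : ops.map (i ≫ j) t = t₄)
    (a : arity.obj (op (ops.elementsMk c t)) ⟶ X) :
    arity.map (CategoryOfElements.homMk (ops.elementsMk c t) (ops.elementsMk c'' t₄)
        (i ≫ j) h).op ≫ a =
      arity.map (CategoryOfElements.homMk (ops.elementsMk c'' t₃) (ops.elementsMk c'' t₄)
          (𝟙 c'') h₄).op ≫
        arity.map (CategoryOfElements.homMk (ops.elementsMk c' t₂) (ops.elementsMk c'' t₃)
          j h₃).op ≫
        arity.map (CategoryOfElements.homMk (ops.elementsMk c t) (ops.elementsMk c' t₂)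
          i h₂).op ≫ a := by
  rw [← Category.assoc, ← Category.assoc, ← arity.map_comp, ← arity.map_comp, ← op_comp,
    ← op_comp]
  congr 3
  apply CategoryOfElements.ext
  simp

/-- The endofunctor `X ↦ ∐_{t ∈ ops c} Hom (arity t, X)` of presheaves on `C`. The category of
elements of a presheaf in the usual sense is the opposite of Mathlib's `Elements`. -/
def familialFunctor (ops : Cᵒᵖ ⥤ Type u) (arity : ops.Elementsᵒᵖ ⥤ Cᵒᵖ ⥤ Type u) :
    (Cᵒᵖ ⥤ Type u) ⥤ Cᵒᵖ ⥤ Type u where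
  obj X :=
    { obj := fun c => Σ t : ops.obj c, arity.obj (op (ops.elementsMk c t)) ⟶ X
      map := fun {c c'} i => TypeCat.ofHom fun p =>
        ⟨ops.map i p.1, arity.map (CategoryOfElements.homMk (ops.elementsMk c p.1)
          (ops.elementsMk c' (ops.map i p.1)) i rfl).op ≫ p.2⟩
      map_id := fun c => by
        refine ConcreteCategory.hom_ext _ _ fun p => ?_
        exact familial_ext (CategoryOfElements.homMk _ _ (𝟙 c) rfl) rfl rfl
      map_comp := fun {c c' c''} i j => by
        refine ConcreteCategory.hom_ext _ _ fun p => ?_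
        refine familial_ext (CategoryOfElements.homMk (ops.elementsMk _ _) (ops.elementsMk _ _)
          (𝟙 c'') (by simp; rfl)) rfl ?_
        exact arity_comp arity i j rfl rfl _ rfl p.2 }
  map f :=
    { app := fun c => TypeCat.ofHom fun p => ⟨p.1, p.2 ≫ f⟩
      naturality := fun c c' i => by
        refine ConcreteCategory.hom_ext _ _ fun p => ?_
        exact congrArg
          (fun q => (⟨_, q⟩ : Σ t : ops.obj c', arity.obj (op (ops.elementsMk c' t)) ⟶ _))
          (Category.assoc _ _ _) }
  map_id X := by
    refine NatTrans.ext (funext fun c => ConcreteCategory.hom_ext _ _ fun p => ?_)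
    exact congrArg (fun q => (⟨_, q⟩ : Σ t : ops.obj c, arity.obj (op (ops.elementsMk c t)) ⟶ _))
      (Category.comp_id _)
  map_comp f g := by
    refine NatTrans.ext (funext fun c => ConcreteCategory.hom_ext _ _ fun p => ?_)
    exact congrArg (fun q => (⟨_, q⟩ : Σ t : ops.obj c, arity.obj (op (ops.elementsMk c t)) ⟶ _))
      (Category.assoc _ _ _).symm

/-- A familial monad on presheaves on `C`: a cartesian monad whose functor part is of the form
`X ↦ ∐_{t ∈ ops c} Hom (arity t, X)`; here `ops` is `T(1)` and `arity` is `T[-]`. (Functors of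
this form preserve pullbacks.) -/
structure FamilialMonad (C : Type u) [SmallCategory C] where
  ops : Cᵒᵖ ⥤ Type u
  arity : ops.Elementsᵒᵖ ⥤ Cᵒᵖ ⥤ Type u
  η : 𝟭 (Cᵒᵖ ⥤ Type u) ⟶ familialFunctor ops arity
  μ : familialFunctor ops arity ⋙ familialFunctor ops arity ⟶ familialFunctor ops arity
  assoc : ∀ X, (familialFunctor ops arity).map (μ.app X) ≫ μ.app X =
    μ.app ((familialFunctor ops arity).obj X) ≫ μ.app X
  left_unit : ∀ X, η.app ((familialFunctor ops arity).obj X) ≫ μ.app X = 𝟙 _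
  right_unit : ∀ X, (familialFunctor ops arity).map (η.app X) ≫ μ.app X = 𝟙 _
  cartesian_η : NatTrans.Equifibered η
  cartesian_μ : NatTrans.Equifibered μ

namespace FamilialMonad

variable (T : FamilialMonad C)

def monad : Monad (Cᵒᵖ ⥤ Type u) where
  toFunctor := familialFunctor T.ops T.arity
  η := T.η
  μ := T.μ
  assoc := T.assoc
  left_unit := T.left_unit
  right_unit := T.right_unit

/-- The category of operations `∫ T(1)`. -/
abbrev Op : Type u := T.ops.Elementsᵒᵖ

/-- The output cell shape of an operation. -/
abbrev shape (t : T.Op) : C := t.unop.1.unop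

/-- The map of cell shapes underlying a map of operations. -/
abbrev shapeMap {s t : T.Op} (k : s ⟶ t) : T.shape s ⟶ T.shape t := k.unop.1.unop

/-- The objects of `C⁺`: the cell shapes `c` of `C`, and an arrow shape for each operation. -/
inductive Plus : Type u
  | cell (c : C) : Plus
  | arrow (t : T.Op) : Plus

/-- The maps of `C⁺`: those of `C`, those of `∫ T(1)`, and from `d` to an operation `t` with output
shape `c` the maps `d ⟶ c` (faces of the target) and the `d`-cells of the arity of `t` (sources). -/
inductive PlusHom : T.Plus → T.Plus → Type u
  | cell {c d : C} (i : c ⟶ d) : PlusHom (.cell c) (.cell d)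
  | face {s t : T.Op} (k : s ⟶ t) : PlusHom (.arrow s) (.arrow t)
  | target {d : C} {t : T.Op} (i : d ⟶ T.shape t) : PlusHom (.cell d) (.arrow t)
  | source {d : C} {t : T.Op} (x : (T.arity.obj t).obj (op d)) : PlusHom (.cell d) (.arrow t)

instance : SmallCategory T.Plus where
  Hom := T.PlusHom
  id
    | .cell c => .cell (𝟙 c)
    | .arrow t => .face (𝟙 t)
  comp
    | .cell i, .cell j => .cell (i ≫ j)
    | .cell i, .target j => .target (i ≫ j)
    | .cell i, .source x => .source ((T.arity.obj _).map i.op x)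
    | .target i, .face k => .target (i ≫ T.shapeMap k)
    | .source x, .face k => .source ((T.arity.map k).app _ x)
    | .face k, .face l => .face (k ≫ l)
  id_comp := by rintro _ _ (i | k | i | x) <;> simp
  comp_id := by
    rintro _ _ (i | k | i | x) <;> simp
    exact Category.comp_id i
  assoc := by
    rintro _ _ _ _ (i | k | i | x) (i' | k' | i' | x') (i'' | k'' | i'' | x'') <;>
      simp
    rfl

/-- The canonical inclusion of `C` in `C⁺`. -/
def incl : C ⥤ T.Plus where
  obj c := .cell c
  map i := PlusHom.cell i
  map_id _ := rfl
  map_comp _ _ := rfl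

/-- The element of `T X` given by an operation and a map from its arity. -/
def elt {X : Cᵒᵖ ⥤ Type u} (t : T.Op) (a : T.arity.obj t ⟶ X) :
    (T.monad.obj X).obj (op (T.shape t)) :=
  (⟨t.unop.2, a⟩ : Σ s : T.ops.obj t.unop.1, T.arity.obj (op (T.ops.elementsMk t.unop.1 s)) ⟶ X)

variable {T}

theorem map_elt {X Y : Cᵒᵖ ⥤ Type u} (f : X ⟶ Y) (t : T.Op) (a : T.arity.obj t ⟶ X) :
    (T.monad.map f).app _ (T.elt t a) = T.elt t (a ≫ f) := rfl

theorem res_elt {X : Cᵒᵖ ⥤ Type u} {s t : T.Op} (k : s ⟶ t) (a : T.arity.obj t ⟶ X) :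
    (T.monad.obj X).map (T.shapeMap k).op (T.elt t a) = T.elt s (T.arity.map k ≫ a) := by
  obtain ⟨⟨c, s⟩⟩ := s
  obtain ⟨⟨d, t⟩⟩ := t
  obtain ⟨⟨i, hi⟩⟩ := k
  change d ⟶ c at i
  change T.ops.map i t = s at hi
  subst hi
  rfl

theorem elt_inj {X : Cᵒᵖ ⥤ Type u} {t : T.Op} {a b : T.arity.obj t ⟶ X}
    (h : T.elt t a = T.elt t b) : a = b := by
  cases h
  rfl

variable (T)

/-- The presheaf on `C⁺` of a `T`-graph: its `c`-cells are the `c`-cells of the graph, and its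
`t`-arrows are the arrows with domain of the form `T[t] ⟶ X₀`, here recorded along with it. -/
def graphPresheafObj (G : TGraph T.monad) : T.Plusᵒᵖ ⥤ Type u where
  obj e := match e with
    | op (.cell c) => G.cells.obj (op c)
    | op (.arrow t) => { p : G.arrows.obj (op (T.shape t)) × (T.arity.obj t ⟶ G.cells) //
        G.dom.app _ p.1 = T.elt t p.2 }
  map {e e'} f := match e, e', f with
    | op (.cell _), op (.cell _), ⟨.cell i⟩ => G.cells.map i.op
    | op (.arrow _), op (.arrow _), ⟨.face k⟩ => TypeCat.ofHom fun p =>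
        ⟨(G.arrows.map (T.shapeMap k).op p.1.1, T.arity.map k ≫ p.1.2), by
          rw [← res_elt, ← p.2]
          exact NatTrans.naturality_apply _ _ _⟩
    | op (.arrow _), op (.cell _), ⟨.target i⟩ => TypeCat.ofHom fun p =>
        G.cells.map i.op (G.cod.app _ p.1.1)
    | op (.arrow _), op (.cell _), ⟨.source x⟩ => TypeCat.ofHom fun p => p.1.2.app _ x
  map_id e := match e with
    | op (.cell c) => G.cells.map_id (op c)
    | op (.arrow t) => by
        refine ConcreteCategory.hom_ext _ _ fun p => Subtype.ext (Prod.ext ?_ ?_)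
        · exact congrArg (fun m => (ConcreteCategory.hom m) p.1.1) (G.arrows.map_id _)
        · exact (congrArg (· ≫ p.1.2) (T.arity.map_id t)).trans (Category.id_comp _)
  map_comp {e e' e''} f g := match e, e', e'', f, g with
    | op (.cell _), op (.cell _), op (.cell _), ⟨.cell i⟩, ⟨.cell j⟩ =>
        G.cells.map_comp i.op j.op
    | op (.arrow _), op (.arrow _), op (.arrow _), ⟨.face k⟩, ⟨.face l⟩ => by
        refine ConcreteCategory.hom_ext _ _ fun p => Subtype.ext (Prod.ext ?_ ?_)
        · exact congrArg (fun m => (ConcreteCategory.hom m) p.1.1)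
            (G.arrows.map_comp (T.shapeMap k).op (T.shapeMap l).op)
        · exact (congrArg (· ≫ p.1.2) (T.arity.map_comp l k)).trans (Category.assoc _ _ _)
    | op (.arrow _), op (.arrow _), op (.cell _), ⟨.face k⟩, ⟨.target i⟩ => by
        refine ConcreteCategory.hom_ext _ _ fun p => ?_
        refine (congrArg (fun m => (ConcreteCategory.hom m) (G.cod.app _ p.1.1))
          (G.cells.map_comp (T.shapeMap k).op i.op)).trans ?_
        exact congrArg (G.cells.map i.op) (NatTrans.naturality_apply G.cod _ _).symm
    | op (.arrow _), op (.arrow _), op (.cell _), ⟨.face k⟩, ⟨.source x⟩ => rfl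
    | op (.arrow _), op (.cell _), op (.cell _), ⟨.target i⟩, ⟨.cell j⟩ => by
        refine ConcreteCategory.hom_ext _ _ fun p => ?_
        exact congrArg (fun m => (ConcreteCategory.hom m) (G.cod.app _ p.1.1))
          (G.cells.map_comp i.op j.op)
    | op (.arrow _), op (.cell _), op (.cell _), ⟨.source x⟩, ⟨.cell j⟩ => by
        refine ConcreteCategory.hom_ext _ _ fun p => ?_
        exact NatTrans.naturality_apply p.1.2 j.op x

/-- The functor from `T`-graphs to presheaves on `C⁺`. -/
def graphPresheaf : TGraph T.monad ⥤ T.Plusᵒᵖ ⥤ Type u where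
  obj G := T.graphPresheafObj G
  map {G H} f :=
    { app := fun e => match e with
        | op (.cell c) => f.onCells.app (op c)
        | op (.arrow t) => TypeCat.ofHom fun p =>
            ⟨(f.onArrows.app _ p.1.1, p.1.2 ≫ f.onCells), by
              have h := congrArg (fun m => (ConcreteCategory.hom (m.app (op (T.shape t)))) p.1.1)
                f.dom_comm
              refine h.trans ?_
              rw [← map_elt, ← p.2]
              rfl⟩
      naturality := fun e e' g => match e, e', g with
        | op (.cell _), op (.cell _), ⟨.cell i⟩ => f.onCells.naturality i.op
        | op (.arrow _), op (.arrow _), ⟨.face k⟩ => by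
            refine ConcreteCategory.hom_ext _ _ fun p => Subtype.ext (Prod.ext ?_ ?_)
            · exact NatTrans.naturality_apply f.onArrows _ _
            · exact Category.assoc _ _ _
        | op (.arrow _), op (.cell _), ⟨.target i⟩ => by
            refine ConcreteCategory.hom_ext _ _ fun p => ?_
            refine (NatTrans.naturality_apply f.onCells i.op _).trans ?_
            exact congrArg (H.cells.map i.op)
              (congrArg (fun m => (ConcreteCategory.hom (m.app _)) p.1.1) f.cod_comm).symm
        | op (.arrow _), op (.cell _), ⟨.source x⟩ => rfl }
  map_id G := by
    refine NatTrans.ext (funext fun e => ConcreteCategory.hom_ext _ _ fun p => ?_)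
    match e with
    | op (.cell c) => rfl
    | op (.arrow t) => exact Subtype.ext (Prod.ext rfl (Category.comp_id _))
  map_comp f g := by
    refine NatTrans.ext (funext fun e => ConcreteCategory.hom_ext _ _ fun p => ?_)
    match e with
    | op (.cell c) => rfl
    | op (.arrow t) => exact Subtype.ext (Prod.ext rfl (Category.assoc _ _ _).symm)

end FamilialMonad
end Familial

section Elements

variable {C : Type u} [SmallCategory C]

/-- An element of a pullback of presheaves. -/
noncomputable def pbElt {X Y Z : Cᵒᵖ ⥤ Type u} (f : X ⟶ Z) (g : Y ⟶ Z) {c : C} (x : X.obj (op c))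
    (y : Y.obj (op c)) (h : f.app _ x = g.app _ y) : (pullback f g).obj (op c) :=
  yonedaEquiv (pullback.lift (yonedaEquiv.symm x) (yonedaEquiv.symm y)
    (yonedaEquiv.injective (by simpa [yonedaEquiv_comp] using h)))

section
variable {X Y Z : Cᵒᵖ ⥤ Type u} {f : X ⟶ Z} {g : Y ⟶ Z} {c : C}

theorem pbElt_fst (x : X.obj (op c)) (y : Y.obj (op c)) (h : f.app _ x = g.app _ y) :
    (pullback.fst f g).app _ (pbElt f g x y h) = x := by
  rw [pbElt, ← yonedaEquiv_comp, pullback.lift_fst, Equiv.apply_symm_apply]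

theorem pbElt_snd (x : X.obj (op c)) (y : Y.obj (op c)) (h : f.app _ x = g.app _ y) :
    (pullback.snd f g).app _ (pbElt f g x y h) = y := by
  rw [pbElt, ← yonedaEquiv_comp, pullback.lift_snd, Equiv.apply_symm_apply]

theorem pb_ext {z z' : (pullback f g).obj (op c)}
    (h₁ : (pullback.fst f g).app _ z = (pullback.fst f g).app _ z')
    (h₂ : (pullback.snd f g).app _ z = (pullback.snd f g).app _ z') : z = z' := by
  apply yonedaEquiv.symm.injective
  apply pullback.hom_ext <;> apply yonedaEquiv.injective <;>
    simpa [yonedaEquiv_comp]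

theorem app_congr {X Y : Cᵒᵖ ⥤ Type u} {f g : X ⟶ Y} (h : f = g) {c : C} (x : X.obj (op c)) :
    f.app _ x = g.app _ x := by rw [h]

theorem pb_cond (z : (pullback f g).obj (op c)) :
    f.app _ ((pullback.fst f g).app _ z) = g.app _ ((pullback.snd f g).app _ z) :=
  app_congr pullback.condition z

theorem isPullback_elt {P X Y Z : Cᵒᵖ ⥤ Type u} {p : P ⟶ X} {q : P ⟶ Y} {f : X ⟶ Z} {g : Y ⟶ Z}
    (sq : IsPullback p q f g) {c : C} (x : X.obj (op c)) (y : Y.obj (op c))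
    (h : f.app _ x = g.app _ y) : ∃ z : P.obj (op c), p.app _ z = x ∧ q.app _ z = y := by
  refine ⟨sq.isoPullback.inv.app _ (pbElt f g x y h), ?_, ?_⟩
  · exact (app_congr sq.isoPullback_inv_fst _).trans (pbElt_fst x y h)
  · exact (app_congr sq.isoPullback_inv_snd _).trans (pbElt_snd x y h)

theorem isPullback_ext {P X Y Z : Cᵒᵖ ⥤ Type u} {p : P ⟶ X} {q : P ⟶ Y} {f : X ⟶ Z} {g : Y ⟶ Z}
    (sq : IsPullback p q f g) {c : C} {z z' : P.obj (op c)} (h₁ : p.app _ z = p.app _ z')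
    (h₂ : q.app _ z = q.app _ z') : z = z' := by
  apply yonedaEquiv.symm.injective
  apply sq.hom_ext <;> apply yonedaEquiv.injective <;> simpa [yonedaEquiv_comp]

theorem pbElt_eta (z : (pullback f g).obj (op c)) :
    pbElt f g _ _ (pb_cond z) = z :=
  pb_ext (pbElt_fst _ _ _) (pbElt_snd _ _ _)

theorem nat_apply {X Y : Cᵒᵖ ⥤ Type u} (f : X ⟶ Y) {c d : C} (i : d ⟶ c) (x : X.obj (op c)) :
    f.app _ (X.map i.op x) = Y.map i.op (f.app _ x) :=
  NatTrans.naturality_apply f i.op x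

theorem hom_ext_elt {X Y : Cᵒᵖ ⥤ Type u} {f g : X ⟶ Y}
    (h : ∀ (c : C) (x : X.obj (op c)), f.app _ x = g.app _ x) : f = g :=
  NatTrans.ext (funext fun _ => ConcreteCategory.hom_ext _ _ fun x => h _ x)

end

namespace FamilialMonad

variable {T : FamilialMonad C}

/-- The operation given by an element of `T(1)`. -/
abbrev opn {c : C} (t : T.ops.obj (op c)) : T.Op := op (T.ops.elementsMk (op c) t)

/-- The element of `T X` given by an operation and a map from its arity. -/
def el {X : Cᵒᵖ ⥤ Type u} {c : C} (t : T.ops.obj (op c)) (a : T.arity.obj (opn t) ⟶ X) :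
    (T.monad.obj X).obj (op c) :=
  T.elt (opn t) a

theorem map_el {X Y : Cᵒᵖ ⥤ Type u} (f : X ⟶ Y) {c : C} (t : T.ops.obj (op c))
    (a : T.arity.obj (opn t) ⟶ X) : (T.monad.map f).app _ (el t a) = el t (a ≫ f) := rfl

theorem exists_el {X : Cᵒᵖ ⥤ Type u} {c : C} (p : (T.monad.obj X).obj (op c)) :
    ∃ (t : T.ops.obj (op c)) (a : T.arity.obj (opn t) ⟶ X), p = el t a :=
  ⟨p.1, p.2, rfl⟩

theorem el_inj {X : Cᵒᵖ ⥤ Type u} {c : C} {t : T.ops.obj (op c)} {a b : T.arity.obj (opn t) ⟶ X}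
    (h : el t a = el t b) : a = b :=
  elt_inj h

theorem el_inj' {X : Cᵒᵖ ⥤ Type u} {c : C} {t s : T.ops.obj (op c)}
    {a : T.arity.obj (opn t) ⟶ X} {b : T.arity.obj (opn s) ⟶ X} (h : el t a = el s b) :
    t = s ∧ HEq a b := by
  cases h
  exact ⟨rfl, HEq.rfl⟩

/-- The map from the restriction of an operation along a face. -/
abbrev resHom {c d : C} (i : d ⟶ c) (t : T.ops.obj (op c)) :
    opn (T.ops.map i.op t) ⟶ opn t :=
  (CategoryOfElements.homMk (T.ops.elementsMk (op c) t)
    (T.ops.elementsMk (op d) (T.ops.map i.op t)) i.op rfl).op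

theorem res_el {X : Cᵒᵖ ⥤ Type u} {c d : C} (i : d ⟶ c) (t : T.ops.obj (op c))
    (a : T.arity.obj (opn t) ⟶ X) :
    (T.monad.obj X).map i.op (el t a) =
      el (T.ops.map i.op t) (T.arity.map (resHom i t) ≫ a) := rfl

theorem nat_eta {X Y : Cᵒᵖ ⥤ Type u} (f : X ⟶ Y) {c : C} (x : X.obj (op c)) :
    (T.monad.map f).app _ ((T.monad.η.app X).app _ x) = (T.monad.η.app Y).app _ (f.app _ x) :=
  (app_congr (T.monad.η.naturality f) x).symm

theorem nat_mu {X Y : Cᵒᵖ ⥤ Type u} (f : X ⟶ Y) {c : C}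
    (x : (T.monad.obj (T.monad.obj X)).obj (op c)) :
    (T.monad.map f).app _ ((T.monad.μ.app X).app _ x) =
      (T.monad.μ.app Y).app _ ((T.monad.map (T.monad.map f)).app _ x) :=
  (app_congr (T.monad.μ.naturality f) x).symm

/-- The lifting property of the naturality squares of `η`. -/
theorem eta_lift {X Y : Cᵒᵖ ⥤ Type u} (f : X ⟶ Y) {c : C} (p : (T.monad.obj X).obj (op c))
    (y : Y.obj (op c)) (h : (T.monad.map f).app _ p = (T.monad.η.app Y).app _ y) :
    ∃ x : X.obj (op c), f.app _ x = y ∧ (T.monad.η.app X).app _ x = p :=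
  isPullback_elt (T.cartesian_η f) y p h.symm

theorem eta_ext {X Y : Cᵒᵖ ⥤ Type u} (f : X ⟶ Y) {c : C} {x x' : X.obj (op c)}
    (h₁ : f.app _ x = f.app _ x')
    (h₂ : (T.monad.η.app X).app _ x = (T.monad.η.app X).app _ x') : x = x' :=
  isPullback_ext (T.cartesian_η f) h₁ h₂

/-- The lifting property of the naturality squares of `μ`. -/
theorem mu_lift {X Y : Cᵒᵖ ⥤ Type u} (f : X ⟶ Y) {c : C} (p : (T.monad.obj X).obj (op c))
    (t : T.ops.obj (op c)) (b : T.arity.obj (opn t) ⟶ T.monad.obj Y)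
    (h : (T.monad.map f).app _ p = (T.monad.μ.app Y).app _ (el t b)) :
    ∃ a : T.arity.obj (opn t) ⟶ T.monad.obj X,
      a ≫ T.monad.map f = b ∧ (T.monad.μ.app X).app _ (el t a) = p := by
  have sq : IsPullback (T.monad.map (T.monad.map f)) (T.monad.μ.app X) (T.monad.μ.app Y)
    (T.monad.map f) := T.cartesian_μ f
  obtain ⟨z, h₁, h₂⟩ := isPullback_elt sq (el t b) p h.symm
  obtain ⟨s, a, rfl⟩ := exists_el z
  rw [map_el] at h₁
  obtain ⟨rfl, -⟩ := el_inj' h₁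
  exact ⟨a, el_inj h₁, h₂⟩

theorem mu_ext {X Y : Cᵒᵖ ⥤ Type u} (f : X ⟶ Y) {c : C} {t : T.ops.obj (op c)}
    {a a' : T.arity.obj (opn t) ⟶ T.monad.obj X}
    (h₁ : a ≫ T.monad.map f = a' ≫ T.monad.map f)
    (h₂ : (T.monad.μ.app X).app _ (el t a) = (T.monad.μ.app X).app _ (el t a')) : a = a' := by
  have sq : IsPullback (T.monad.map (T.monad.map f)) (T.monad.μ.app X) (T.monad.μ.app Y)
    (T.monad.map f) := T.cartesian_μ f
  refine el_inj (isPullback_ext sq ?_ h₂)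
  rw [map_el, map_el, h₁]

end FamilialMonad

namespace Multicat

variable {T : FamilialMonad C} (W : Multicat T.monad)

/-- The presheaf of composable pairs. -/
noncomputable abbrev pairs : Cᵒᵖ ⥤ Type u := pullback (T.monad.map W.cod) W.dom

noncomputable abbrev pfst : W.pairs ⟶ T.monad.obj W.arrows := pullback.fst _ _

noncomputable abbrev psnd : W.pairs ⟶ W.arrows := pullback.snd _ _

/-- Composition in a `T`-multicategory, on elements. -/
noncomputable def compose {c : C} (p : (T.monad.obj W.arrows).obj (op c)) (q : W.arrows.obj (op c))
    (h : (T.monad.map W.cod).app _ p = W.dom.app _ q) : W.arrows.obj (op c) :=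
  W.comp.app _ (pbElt _ _ p q h)

theorem compose_pair {c : C} (z : (pullback (T.monad.map W.cod) W.dom).obj (op c)) :
    W.compose _ _ (pb_cond z) = W.comp.app _ z := by
  rw [compose, pbElt_eta]

theorem compose_congr {c : C} {p p' : (T.monad.obj W.arrows).obj (op c)}
    {q q' : W.arrows.obj (op c)} (h : (T.monad.map W.cod).app _ p = W.dom.app _ q)
    (hp : p = p') (hq : q = q') : W.compose p q h = W.compose p' q' (hp ▸ hq ▸ h) := by
  subst hp hq; rfl

theorem dom_compose {c : C} (p : (T.monad.obj W.arrows).obj (op c)) (q : W.arrows.obj (op c))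
    (h : (T.monad.map W.cod).app _ p = W.dom.app _ q) :
    W.dom.app _ (W.compose p q h) =
      (T.monad.μ.app _).app _ ((T.monad.map W.dom).app _ p) := by
  refine (app_congr W.comp_dom (pbElt _ _ p q h)).trans ?_
  change (T.monad.μ.app _).app _ ((T.monad.map W.dom).app _
    (W.pfst.app _ (pbElt _ _ p q h))) = _
  rw [pbElt_fst]

theorem cod_compose {c : C} (p : (T.monad.obj W.arrows).obj (op c)) (q : W.arrows.obj (op c))
    (h : (T.monad.map W.cod).app _ p = W.dom.app _ q) :
    W.cod.app _ (W.compose p q h) = W.cod.app _ q := by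
  refine (app_congr W.comp_cod (pbElt _ _ p q h)).trans ?_
  change W.cod.app _ (W.psnd.app _ (pbElt _ _ p q h)) = _
  rw [pbElt_snd]

theorem res_compose {c d : C} (i : d ⟶ c) (p : (T.monad.obj W.arrows).obj (op c))
    (q : W.arrows.obj (op c)) (h : (T.monad.map W.cod).app _ p = W.dom.app _ q) :
    W.arrows.map i.op (W.compose p q h) =
      W.compose ((T.monad.obj W.arrows).map i.op p) (W.arrows.map i.op q)
        (by rw [nat_apply, nat_apply, h]) := by
  rw [compose, ← nat_apply, compose]
  congr 1
  apply pb_ext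
  · rw [nat_apply, pbElt_fst, pbElt_fst]
  · rw [nat_apply, pbElt_snd, pbElt_snd]

theorem compose_ids {c : C} (q : W.arrows.obj (op c))
    (h : (T.monad.map W.cod).app _ ((T.monad.η.app _).app _ q) =
      W.dom.app _ (W.ids.app _ (W.cod.app _ q))) :
    W.compose ((T.monad.η.app _).app _ q) (W.ids.app _ (W.cod.app _ q)) h = q := by
  refine Eq.trans ?_ (app_congr W.comp_ids q)
  refine congrArg (W.comp.app (op c)) (pb_ext ?_ ?_)
  · refine (pbElt_fst _ _ h).trans (Eq.symm ?_)
    exact (app_congr (pullback.lift_fst _ _ _) q).trans rfl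
  · refine (pbElt_snd _ _ h).trans (Eq.symm ?_)
    exact (app_congr (pullback.lift_snd _ _ _) q).trans rfl

theorem ids_compose {c : C} (q : W.arrows.obj (op c))
    (h : (T.monad.map W.cod).app _ ((T.monad.map W.ids).app _ (W.dom.app _ q)) =
      W.dom.app _ q) :
    W.compose ((T.monad.map W.ids).app _ (W.dom.app _ q)) q h = q := by
  refine Eq.trans ?_ (app_congr W.ids_comp q)
  refine congrArg (W.comp.app (op c)) (pb_ext ?_ ?_)
  · refine (pbElt_fst _ _ h).trans (Eq.symm ?_)
    exact (app_congr (pullback.lift_fst _ _ _) q).trans rfl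
  · refine (pbElt_snd _ _ h).trans (Eq.symm ?_)
    exact (app_congr (pullback.lift_snd _ _ _) q).trans rfl

theorem compose_assoc {c : C} (P : (T.monad.obj W.pairs).obj (op c)) (q : W.arrows.obj (op c))
    (h : (T.monad.map W.cod).app _ ((T.monad.map W.psnd).app _ P) = W.dom.app _ q)
    (h₁ : (T.monad.map W.cod).app _ ((T.monad.map W.comp).app _ P) = W.dom.app _ q)
    (h₂ : (T.monad.map W.cod).app _ ((T.monad.μ.app _).app _
      ((T.monad.map W.pfst).app _ P)) = W.dom.app _ (W.compose _ q h)) :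
    W.compose ((T.monad.map W.comp).app _ P) q h₁ =
      W.compose ((T.monad.μ.app _).app _ ((T.monad.map W.pfst).app _ P)) (W.compose _ q h) h₂ := by
  have h₀ : (T.monad.map (W.psnd ≫ W.cod)).app _ P = W.dom.app _ q := by
    rw [T.monad.map_comp]; exact h
  let z := pbElt (T.monad.map (W.psnd ≫ W.cod)) W.dom P q h₀
  have hz₁ : (pullback.fst (T.monad.map (W.psnd ≫ W.cod)) W.dom).app _ z = P := pbElt_fst _ _ _
  have hz₂ : (pullback.snd (T.monad.map (W.psnd ≫ W.cod)) W.dom).app _ z = q := pbElt_snd _ _ _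
  have hz := app_congr W.comp_assoc z
  refine Eq.trans ?_ (hz.trans ?_)
  · refine congrArg (W.comp.app (op c)) (pb_ext ?_ ?_)
    · refine (pbElt_fst _ _ h₁).trans ((app_congr (pullback.lift_fst _ _ _) z).trans ?_).symm
      exact congrArg ((T.monad.map W.comp).app (op c)) hz₁
    · refine (pbElt_snd _ _ h₁).trans ((app_congr (pullback.lift_snd _ _ _) z).trans ?_).symm
      exact hz₂
  · refine congrArg (W.comp.app (op c)) (pb_ext ?_ ?_)
    · refine Eq.trans ?_ (pbElt_fst _ _ h₂).symm
      refine (app_congr (pullback.lift_fst _ _ _) z).trans ?_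
      exact congrArg (fun P => (T.monad.μ.app W.arrows).app (op c)
        ((T.monad.map W.pfst).app _ P)) hz₁
    · refine Eq.trans ?_ (pbElt_snd _ _ h₂).symm
      refine (app_congr (pullback.lift_snd _ _ _) z).trans ?_
      refine congrArg (W.comp.app (op c)) (pb_ext ?_ ?_)
      · refine Eq.trans ?_ (pbElt_fst _ _ h).symm
        refine (app_congr (pullback.lift_fst _ _ _) z).trans ?_
        exact congrArg ((T.monad.map W.psnd).app (op c)) hz₁
      · refine Eq.trans ?_ (pbElt_snd _ _ h).symm
        exact (app_congr (pullback.lift_snd _ _ _) z).trans hz₂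

/-- A map of `T`-graphs is a `T`-multifunctor if it commutes with identities and composites of
elements. -/
theorem map_comp_of {V W : Multicat T.monad} (f : V.toTGraph ⟶ W.toTGraph)
    (h : ∀ (c : C) p q (hpq : (T.monad.map V.cod).app (op c) p = V.dom.app _ q)
      (hpq' : (T.monad.map W.cod).app (op c) ((T.monad.map f.onArrows).app _ p) =
        W.dom.app _ (f.onArrows.app _ q)), f.onArrows.app _ (V.compose p q hpq) =
      W.compose ((T.monad.map f.onArrows).app _ p) (f.onArrows.app _ q) hpq') :
    V.comp ≫ f.onArrows = f.onPairs ≫ W.comp := by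
  apply hom_ext_elt
  intro c z
  change f.onArrows.app _ (V.comp.app _ z) = W.comp.app _ (f.onPairs.app _ z)
  rw [← compose_pair, ← compose_pair]
  have h₁ := app_congr (onPairs_fst f) z
  have h₂ := app_congr (onPairs_snd f) z
  refine (h c _ _ _ ?_).trans (W.compose_congr _ h₁.symm h₂.symm)
  refine (congrArg ((T.monad.map W.cod).app (op c)) h₁.symm).trans
    ((pb_cond _).trans (congrArg (W.dom.app (op c)) h₂))

theorem onArrows_compose {V W : Multicat T.monad} (f : V ⟶ W) {c : C}
    (p : (T.monad.obj V.arrows).obj (op c)) (q : V.arrows.obj (op c))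
    (hpq : (T.monad.map V.cod).app _ p = V.dom.app _ q)
    (hpq' : (T.monad.map W.cod).app _ ((T.monad.map f.onArrows).app _ p) =
        W.dom.app _ (f.onArrows.app _ q)) :
    f.onArrows.app _ (V.compose p q hpq) =
      W.compose ((T.monad.map f.onArrows).app _ p) (f.onArrows.app _ q) hpq' := by
  have h := app_congr f.map_comp (pbElt _ _ p q hpq)
  refine h.trans ?_
  refine congrArg (W.comp.app (op c)) (pb_ext ?_ ?_)
  · rw [pbElt_fst]
    refine (app_congr (onPairs_fst f.toHom) _).trans ?_
    exact congrArg ((T.monad.map f.onArrows).app (op c)) (pbElt_fst _ _ _)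
  · rw [pbElt_snd]
    refine (app_congr (onPairs_snd f.toHom) _).trans ?_
    exact congrArg (f.onArrows.app (op c)) (pbElt_snd _ _ _)

end Multicat
end Elements

section FreeMulticategories

namespace FamilialMonad

variable {C : Type u} [SmallCategory C] {T : FamilialMonad C} (X : T.Plusᵒᵖ ⥤ Type u)

/-- The presheaf of `C`-cells of a presheaf on `C⁺`. -/
abbrev cellsOf : Cᵒᵖ ⥤ Type u := T.incl.op ⋙ X

variable {X}

/-- The face of an arrow of `X` along a map of operations. -/
def faceOf {s t : T.Op} (k : s ⟶ t) (y : X.obj (op (.arrow t))) : X.obj (op (.arrow s)) :=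
  X.map (Quiver.Hom.op (X := Plus.arrow s) (Y := Plus.arrow t) (PlusHom.face k)) y

/-- The target of an arrow of `X`. -/
def tgtOf {t : T.Op} (y : X.obj (op (.arrow t))) : (cellsOf X).obj (op (T.shape t)) :=
  X.map (Quiver.Hom.op (X := Plus.cell (T.shape t)) (Y := Plus.arrow t) (PlusHom.target (𝟙 _))) y

/-- The source of an arrow of `X`. -/
def srcOf {t : T.Op} (y : X.obj (op (.arrow t))) : T.arity.obj t ⟶ cellsOf X where
  app d := TypeCat.ofHom fun x => X.map (Quiver.Hom.op (X := Plus.cell d.unop) (Y := Plus.arrow t)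
    (PlusHom.source x)) y
  naturality d d' i := by
    refine ConcreteCategory.hom_ext _ _ fun x => ?_
    exact congrArg (fun m => (ConcreteCategory.hom m) y) (X.map_comp
      (Quiver.Hom.op (X := Plus.cell d.unop) (Y := Plus.arrow t) (PlusHom.source x))
      (Quiver.Hom.op (X := Plus.cell d'.unop) (Y := Plus.cell d.unop) (PlusHom.cell i.unop)))

theorem faceOf_id {t : T.Op} (y : X.obj (op (.arrow t))) : faceOf (𝟙 t) y = y :=
  congrArg (fun m => (ConcreteCategory.hom m) y) (X.map_id (op (.arrow t)))

theorem faceOf_comp {r s t : T.Op} (k : r ⟶ s) (l : s ⟶ t) (y : X.obj (op (.arrow t))) :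
    faceOf (k ≫ l) y = faceOf k (faceOf l y) :=
  congrArg (fun m => (ConcreteCategory.hom m) y) (X.map_comp
    (Quiver.Hom.op (X := Plus.arrow s) (Y := Plus.arrow t) (PlusHom.face l))
    (Quiver.Hom.op (X := Plus.arrow r) (Y := Plus.arrow s) (PlusHom.face k)))

theorem tgtOf_faceOf {s t : T.Op} (k : s ⟶ t) (y : X.obj (op (.arrow t))) :
    tgtOf (faceOf k y) = (cellsOf X).map (T.shapeMap k).op (tgtOf y) := by
  have h₁ := congrArg (fun m => (ConcreteCategory.hom m) y) (X.map_comp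
    (Quiver.Hom.op (X := Plus.arrow s) (Y := Plus.arrow t) (PlusHom.face k))
    (Quiver.Hom.op (X := Plus.cell (T.shape s)) (Y := Plus.arrow s) (PlusHom.target (𝟙 _))))
  have h₂ := congrArg (fun m => (ConcreteCategory.hom m) y) (X.map_comp
    (Quiver.Hom.op (X := Plus.cell (T.shape t)) (Y := Plus.arrow t) (PlusHom.target (𝟙 _)))
    (Quiver.Hom.op (X := Plus.cell (T.shape s)) (Y := Plus.cell (T.shape t))
      (PlusHom.cell (T.shapeMap k))))
  refine h₁.symm.trans (Eq.trans ?_ h₂)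
  refine congrArg (fun m => (ConcreteCategory.hom (X.map m)) y) ?_
  refine congrArg (Quiver.Hom.op (X := Plus.cell (T.shape s)) (Y := Plus.arrow t)) ?_
  exact congrArg PlusHom.target ((Category.id_comp _).trans (Category.comp_id _).symm)

theorem srcOf_faceOf {s t : T.Op} (k : s ⟶ t) (y : X.obj (op (.arrow t))) :
    srcOf (faceOf k y) = T.arity.map k ≫ srcOf y := by
  apply hom_ext_elt
  intro d x
  exact (congrArg (fun m => (ConcreteCategory.hom m) y) (X.map_comp
    (Quiver.Hom.op (X := Plus.arrow s) (Y := Plus.arrow t) (PlusHom.face k))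
    (Quiver.Hom.op (X := Plus.cell d) (Y := Plus.arrow s) (PlusHom.source x)))).symm

variable (X)

/-- Trees whose nodes are labelled by arrows of `X`, with a subtree for each cell of the arity of
the operation of the node, and whose leaves are labelled by cells of `X`. -/
inductive PreTree : C → Type u
  | leaf {c : C} (x : (cellsOf X).obj (op c)) : PreTree c
  | node {c : C} (t : T.ops.obj (op c)) (y : X.obj (op (.arrow (opn t))))
      (ch : ∀ d : C, (T.arity.obj (opn t)).obj (op d) → PreTree d) : PreTree c

variable {X}

namespace PreTree

/-- The faces of a tree. -/
def res {c d : C} (i : d ⟶ c) : PreTree X c → PreTree X d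
  | leaf x => leaf ((cellsOf X).map i.op x)
  | node t y ch => node (T.ops.map i.op t) (faceOf (resHom i t) y)
      fun e x => ch e ((T.arity.map (resHom i t)).app (op e) x)

/-- The codomain of a tree. -/
def cod {c : C} : PreTree X c → (cellsOf X).obj (op c)
  | leaf x => x
  | node _ y _ => tgtOf y

theorem node_ext {c : C} {s t : T.ops.obj (op c)} (k : opn s ⟶ opn t) (hk : T.shapeMap k = 𝟙 c)
    (y : X.obj (op (.arrow (opn t))))
    (ch : ∀ d : C, (T.arity.obj (opn t)).obj (op d) → PreTree X d) :
    node s (faceOf k y) (fun e x => ch e ((T.arity.map k).app (op e) x)) = node t y ch := by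
  obtain ⟨⟨i, hi⟩⟩ := k
  change op c ⟶ op c at i
  change T.ops.map i t = s at hi
  have hi' : i = 𝟙 (op c) := Quiver.Hom.unop_inj hk
  subst hi'
  have hs : s = t := by rw [← hi]; simp
  subst hs
  have : (Quiver.Hom.op ⟨𝟙 (op c), hi⟩ : opn s ⟶ opn s) = 𝟙 (opn s) := rfl
  change node s (faceOf (Quiver.Hom.op ⟨𝟙 (op c), hi⟩ : opn s ⟶ opn s) y) (fun e x => ch e
    ((T.arity.map (Quiver.Hom.op ⟨𝟙 (op c), hi⟩ : opn s ⟶ opn s)).app (op e) x)) = _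
  rw [this, faceOf_id, T.arity.map_id]
  rfl

theorem res_id {c : C} (p : PreTree X c) : res (𝟙 c) p = p := by
  cases p with
  | leaf x => exact congrArg leaf (congrArg (fun m => (ConcreteCategory.hom m) x)
      ((cellsOf X).map_id (op c)))
  | node t y ch => exact node_ext (resHom (𝟙 c) t) rfl y ch

theorem res_comp {c d e : C} (i : d ⟶ c) (j : e ⟶ d) (p : PreTree X c) :
    res (j ≫ i) p = res j (res i p) := by
  cases p with
  | leaf x => exact congrArg leaf (congrArg (fun m => (ConcreteCategory.hom m) x)
      ((cellsOf X).map_comp i.op j.op))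
  | node t y ch =>
    have h := node_ext (X := X) (s := T.ops.map (j ≫ i).op t)
      (t := T.ops.map j.op (T.ops.map i.op t))
      (CategoryOfElements.homMk (T.ops.elementsMk (op e) (T.ops.map j.op (T.ops.map i.op t)))
        (T.ops.elementsMk (op e) (T.ops.map (j ≫ i).op t)) (𝟙 _)
        (by simp)).op rfl (faceOf (resHom j _) (faceOf (resHom i t) y))
      (fun f x => ch f ((T.arity.map (resHom i t)).app (op f)
        ((T.arity.map (resHom j _)).app (op f) x)))
    refine Eq.trans ?_ h
    rw [← faceOf_comp, ← faceOf_comp, Category.assoc]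
    have hk : resHom (j ≫ i) t = (CategoryOfElements.homMk (T.ops.elementsMk (op e)
        (T.ops.map j.op (T.ops.map i.op t))) (T.ops.elementsMk (op e) (T.ops.map (j ≫ i).op t))
        (𝟙 _) (by simp)).op ≫ resHom j _ ≫ resHom i t := by
      apply Quiver.Hom.unop_inj
      apply CategoryOfElements.ext
      simp
    change node (T.ops.map (j ≫ i).op t) (faceOf (resHom (j ≫ i) t) y)
      (fun f x => ch f ((T.arity.map (resHom (j ≫ i) t)).app (op f) x)) = _
    rw [hk, T.arity.map_comp, T.arity.map_comp]
    rfl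

theorem cod_res {c d : C} (i : d ⟶ c) (p : PreTree X c) :
    (res i p).cod = (cellsOf X).map i.op p.cod := by
  cases p with
  | leaf x => rfl
  | node t y ch => exact tgtOf_faceOf (resHom i t) y

/-- `Dom p a` says that `p` is a composable diagram of arrows of `X`, with domain `a`: the subtrees
at each node form a map of presheaves on the arity, the codomains of the subtrees form the source of
the label of the node, and the domains of the subtrees are combined by the multiplication of `T`. -/
inductive Dom : ∀ {c : C}, PreTree X c → (T.monad.obj (cellsOf X)).obj (op c) → Prop
  | leaf {c : C} (x : (cellsOf X).obj (op c)) : Dom (.leaf x) ((T.monad.η.app _).app _ x)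
  | node {c : C} (t : T.ops.obj (op c)) (y : X.obj (op (.arrow (opn t))))
      (ch : ∀ d : C, (T.arity.obj (opn t)).obj (op d) → PreTree X d)
      (hch : ∀ (d e : C) (j : e ⟶ d) (x : (T.arity.obj (opn t)).obj (op d)),
        ch e ((T.arity.obj (opn t)).map j.op x) = res j (ch d x))
      (hcod : ∀ (d : C) (x : (T.arity.obj (opn t)).obj (op d)),
        (ch d x).cod = (srcOf y).app (op d) x)
      (a : T.arity.obj (opn t) ⟶ T.monad.obj (cellsOf X))
      (ha : ∀ (d : C) (x : (T.arity.obj (opn t)).obj (op d)), Dom (ch d x) (a.app (op d) x)) :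
      Dom (.node t y ch) ((T.monad.μ.app _).app _ (el t a))

theorem res_eta {Y : Cᵒᵖ ⥤ Type u} {c d : C} (i : d ⟶ c) (x : Y.obj (op c)) :
    (T.monad.obj Y).map i.op ((T.monad.η.app Y).app _ x) =
      (T.monad.η.app Y).app _ (Y.map i.op x) :=
  (nat_apply (T.monad.η.app Y) i x).symm

theorem res_mu {Y : Cᵒᵖ ⥤ Type u} {c d : C} (i : d ⟶ c) (t : T.ops.obj (op c))
    (a : T.arity.obj (opn t) ⟶ T.monad.obj Y) :
    (T.monad.obj Y).map i.op ((T.monad.μ.app Y).app _ (el t a)) =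
      (T.monad.μ.app Y).app _ (el (T.ops.map i.op t) (T.arity.map (resHom i t) ≫ a)) :=
  (nat_apply (T.monad.μ.app Y) i (el t a)).symm

theorem Dom.res {c d : C} (i : d ⟶ c) {p : PreTree X c}
    {a : (T.monad.obj (cellsOf X)).obj (op c)} (h : Dom p a) :
    Dom (p.res i) ((T.monad.obj (cellsOf X)).map i.op a) := by
  cases h with
  | leaf x =>
    rw [res_eta]
    exact Dom.leaf _
  | node t y ch hch hcod a ha =>
    rw [res_mu]
    exact Dom.node (T.ops.map i.op t) (faceOf (resHom i t) y)
      (fun e x => ch e ((T.arity.map (resHom i t)).app (op e) x))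
      (fun d e j x => (congrArg (ch e) (nat_apply (T.arity.map (resHom i t)) j x)).trans
        (hch d e j _))
      (fun d x => (hcod _ _).trans (app_congr (srcOf_faceOf (resHom i t) y) x).symm)
      (T.arity.map (resHom i t) ≫ a) (fun d x => ha d _)

theorem Dom.unique {c : C} {p : PreTree X c} {a b : (T.monad.obj (cellsOf X)).obj (op c)}
    (h : Dom p a) (h' : Dom p b) : a = b := by
  induction h with
  | leaf x => cases h'; rfl
  | node t y ch hch hcod a ha ih =>
    cases h' with
    | node _ _ _ _ _ a' ha' =>
      rw [show a = a' from hom_ext_elt fun d x => ih d x (ha' d x)]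

end PreTree

variable (X)

/-- The composable diagrams of arrows of `X`. -/
def Tree : Cᵒᵖ ⥤ Type u where
  obj c := { p : PreTree X c.unop × (T.monad.obj (cellsOf X)).obj (op c.unop) //
    PreTree.Dom p.1 p.2 }
  map i := TypeCat.ofHom fun p =>
    ⟨(p.1.1.res i.unop, (T.monad.obj (cellsOf X)).map i p.1.2), p.2.res i.unop⟩
  map_id _ := by
    refine ConcreteCategory.hom_ext _ _ fun p => Subtype.ext (Prod.ext ?_ ?_)
    · exact PreTree.res_id _
    · exact congrArg (fun m => (ConcreteCategory.hom m) p.1.2) ((T.monad.obj (cellsOf X)).map_id _)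
  map_comp i j := by
    refine ConcreteCategory.hom_ext _ _ fun p => Subtype.ext (Prod.ext ?_ ?_)
    · exact PreTree.res_comp _ _ _
    · exact congrArg (fun m => (ConcreteCategory.hom m) p.1.2)
        ((T.monad.obj (cellsOf X)).map_comp i j)

namespace Tree

def dom : Tree X ⟶ T.monad.obj (cellsOf X) where
  app _ := TypeCat.ofHom fun p => p.1.2
  naturality _ _ _ := rfl

def cod : Tree X ⟶ cellsOf X where
  app _ := TypeCat.ofHom fun p => p.1.1.cod
  naturality _ _ i := ConcreteCategory.hom_ext _ _ fun p => PreTree.cod_res i.unop p.1.1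

def leaf : cellsOf X ⟶ Tree X where
  app c := TypeCat.ofHom fun x => ⟨(.leaf x, (T.monad.η.app (cellsOf X)).app c x), .leaf x⟩
  naturality c d i := by
    refine ConcreteCategory.hom_ext _ _ fun x => Subtype.ext (Prod.ext ?_ ?_)
    · rfl
    · exact nat_apply (T.monad.η.app (cellsOf X)) i.unop x

variable {X}

def node {c : C} (t : T.ops.obj (op c)) (y : X.obj (op (.arrow (opn t))))
    (β : T.arity.obj (opn t) ⟶ Tree X) (h : β ≫ cod X = srcOf y) : (Tree X).obj (op c) :=
  ⟨(.node t y fun d x => (β.app (op d) x).1.1,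
    (T.monad.μ.app (cellsOf X)).app _ (el t (β ≫ dom X))),
    .node t y _ (fun _ _ j x => congrArg (fun z => z.1.1) (nat_apply β j x))
      (fun _ x => app_congr h x) _ (fun d x => (β.app (op d) x).2)⟩

theorem dom_leaf {c : C} (x : (cellsOf X).obj (op c)) :
    (dom X).app _ ((leaf X).app _ x) = (T.monad.η.app _).app _ x := rfl

theorem cod_leaf {c : C} (x : (cellsOf X).obj (op c)) :
    (cod X).app _ ((leaf X).app _ x) = x := rfl

theorem dom_node {c : C} (t : T.ops.obj (op c)) (y : X.obj (op (.arrow (opn t))))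
    (β : T.arity.obj (opn t) ⟶ Tree X) (h : β ≫ cod X = srcOf y) :
    (dom X).app _ (node t y β h) = (T.monad.μ.app _).app _ (el t (β ≫ dom X)) := rfl

theorem cod_node {c : C} (t : T.ops.obj (op c)) (y : X.obj (op (.arrow (opn t))))
    (β : T.arity.obj (opn t) ⟶ Tree X) (h : β ≫ cod X = srcOf y) :
    (cod X).app _ (node t y β h) = tgtOf y := rfl

theorem res_node {c d : C} (i : d ⟶ c) (t : T.ops.obj (op c)) (y : X.obj (op (.arrow (opn t))))
    (β : T.arity.obj (opn t) ⟶ Tree X) (h : β ≫ cod X = srcOf y) :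
    (Tree X).map i.op (node t y β h) =
      node (T.ops.map i.op t) (faceOf (resHom i t) y) (T.arity.map (resHom i t) ≫ β)
        (by rw [Category.assoc, h, srcOf_faceOf]) :=
  Subtype.ext (Prod.ext rfl (nat_apply (T.monad.μ.app (cellsOf X)) i (el t (β ≫ dom X))).symm)

theorem induct {P : ∀ c : C, (Tree X).obj (op c) → Prop}
    (hleaf : ∀ (c : C) (x : (cellsOf X).obj (op c)), P c ((leaf X).app _ x))
    (hnode : ∀ (c : C) (t : T.ops.obj (op c)) (y : X.obj (op (.arrow (opn t))))
      (β : T.arity.obj (opn t) ⟶ Tree X) (h : β ≫ cod X = srcOf y),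
      (∀ (d : C) (x : (T.arity.obj (opn t)).obj (op d)), P d (β.app _ x)) →
        P c (node t y β h)) {c : C} (τ : (Tree X).obj (op c)) : P c τ := by
  suffices H : ∀ (c : C) (p : PreTree X c) (a : (T.monad.obj (cellsOf X)).obj (op c))
      (h : PreTree.Dom p a), P c ⟨(p, a), h⟩ from H c τ.1.1 τ.1.2 τ.2
  intro c p a h
  induction h with
  | leaf x => exact hleaf _ x
  | node t y ch hch hcod a ha ih =>
    let β : T.arity.obj (opn t) ⟶ Tree X :=
      { app := fun d => TypeCat.ofHom fun x => ⟨(ch d.unop x, a.app d x), ha d.unop x⟩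
        naturality := fun d e j => by
          refine ConcreteCategory.hom_ext _ _ fun x => Subtype.ext (Prod.ext ?_ ?_)
          · exact hch _ _ j.unop x
          · exact nat_apply a j.unop x }
    exact hnode _ t y β (hom_ext_elt hcod) ih

theorem node_inj {c : C} {s t : T.ops.obj (op c)} {y : X.obj (op (.arrow (opn s)))}
    {β : T.arity.obj (opn s) ⟶ Tree X} {h : β ≫ cod X = srcOf y}
    {y' : X.obj (op (.arrow (opn t)))} {β' : T.arity.obj (opn t) ⟶ Tree X}
    {h' : β' ≫ cod X = srcOf y'} (e : node s y β h = node t y' β' h') :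
    s = t ∧ HEq y y' ∧ HEq β β' := by
  have h₁ := congrArg (fun z => z.1.1) e
  change PreTree.node s y _ = PreTree.node t y' _ at h₁
  injection h₁ with _ h₂ h₃ h₄
  subst h₂
  refine ⟨rfl, h₃, heq_of_eq ?_⟩
  apply hom_ext_elt
  intro d x
  have h₅ := congrFun (congrFun (eq_of_heq h₄) d) x
  have h₆ := (β.app (op d) x).2
  rw [h₅] at h₆
  exact Subtype.ext (Prod.ext h₅ (h₆.unique (β'.app (op d) x).2))

theorem leaf_ne_node {c : C} {x : (cellsOf X).obj (op c)} {t : T.ops.obj (op c)}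
    {y : X.obj (op (.arrow (opn t)))} {β : T.arity.obj (opn t) ⟶ Tree X}
    {h : β ≫ cod X = srcOf y} (e : (leaf X).app _ x = node t y β h) : False := by
  have h₁ := congrArg (fun z => z.1.1) e
  change PreTree.leaf _ = PreTree.node t y _ at h₁
  injection h₁

end Tree
end FamilialMonad
end FreeMulticategories

section FreeMulticategories

namespace FamilialMonad

variable {C : Type u} [SmallCategory C] {T : FamilialMonad C} (X : T.Plusᵒᵖ ⥤ Type u)

namespace Tree

/-- `Graft p τ r` says that `r` is obtained by grafting the trees of `p` on the leaves of `τ`. -/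
inductive Graft : ∀ {c : C}, (T.monad.obj (Tree X)).obj (op c) → (Tree X).obj (op c) →
    (Tree X).obj (op c) → Prop
  | leaf {c : C} {p : (T.monad.obj (Tree X)).obj (op c)} {τ r : (Tree X).obj (op c)}
      (hp : (T.monad.η.app (Tree X)).app _ r = p) (hτ : (leaf X).app _ ((cod X).app _ r) = τ) :
      Graft p τ r
  | node {c : C} {p : (T.monad.obj (Tree X)).obj (op c)} {τ r : (Tree X).obj (op c)}
      (t : T.ops.obj (op c)) (y : X.obj (op (.arrow (opn t))))
      (β : T.arity.obj (opn t) ⟶ Tree X) (h : β ≫ cod X = srcOf y)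
      (B : T.arity.obj (opn t) ⟶ T.monad.obj (Tree X))
      (ρ : T.arity.obj (opn t) ⟶ Tree X) (hρ : ρ ≫ cod X = srcOf y)
      (hB : ∀ (d : C) (x : (T.arity.obj (opn t)).obj (op d)),
        Graft (B.app _ x) (β.app _ x) (ρ.app _ x))
      (hp : (T.monad.μ.app (Tree X)).app _ (el t B) = p) (hτ : node t y β h = τ)
      (hr : node t y ρ hρ = r) :
      Graft p τ r

variable {X}

theorem Graft.cod_eq {c : C} {p : (T.monad.obj (Tree X)).obj (op c)} {τ r : (Tree X).obj (op c)}
    (h : Graft X p τ r) : (cod X).app _ r = (cod X).app _ τ := by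
  cases h with
  | leaf hp hτ => rw [← hτ]; rfl
  | node t y β h B ρ hρ hB hp hτ hr => rw [← hτ, ← hr]; rfl

theorem Graft.cond {c : C} {p : (T.monad.obj (Tree X)).obj (op c)} {τ r : (Tree X).obj (op c)}
    (h : Graft X p τ r) : (T.monad.map (cod X)).app _ p = (dom X).app _ τ := by
  induction h with
  | leaf hp hτ => rw [← hp, ← hτ]; exact nat_eta _ _
  | node t y β h B ρ hρ hB hp hτ hr ih =>
    rw [← hp, ← hτ, dom_node, nat_mu, map_el]
    congr 2
    exact hom_ext_elt ih

theorem Graft.dom_eq {c : C} {p : (T.monad.obj (Tree X)).obj (op c)} {τ r : (Tree X).obj (op c)}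
    (h : Graft X p τ r) :
    (dom X).app _ r = (T.monad.μ.app _).app _ ((T.monad.map (dom X)).app _ p) := by
  induction h with
  | leaf hp hτ =>
    rw [← hp, nat_eta]
    exact (app_congr (T.monad.left_unit (cellsOf X)) _).symm
  | node t y β h B ρ hρ hB hp hτ hr ih =>
    rw [← hr, ← hp, dom_node, nat_mu, map_el]
    have e : ρ ≫ dom X = (B ≫ T.monad.map (dom X)) ≫ T.monad.μ.app (cellsOf X) :=
      hom_ext_elt ih
    rw [e, ← map_el]
    exact app_congr (T.monad.assoc (cellsOf X)) (el t (B ≫ T.monad.map (dom X)))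

theorem Graft.res {c d : C} (i : d ⟶ c) {p : (T.monad.obj (Tree X)).obj (op c)}
    {τ r : (Tree X).obj (op c)} (h : Graft X p τ r) :
    Graft X ((T.monad.obj (Tree X)).map i.op p) ((Tree X).map i.op τ) ((Tree X).map i.op r) := by
  cases h with
  | leaf hp hτ =>
    refine Graft.leaf ?_ ?_
    · rw [← hp, PreTree.res_eta]
    · rw [← hτ, ← nat_apply, ← nat_apply]
  | node t y β h B ρ hρ hB hp hτ hr =>
    rw [← hp, ← hτ, ← hr, PreTree.res_mu, res_node, res_node]
    exact Graft.node _ _ _ _ _ _ _ (fun d x => hB d _) rfl rfl rfl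

theorem leaf_inj {c : C} {x x' : (cellsOf X).obj (op c)}
    (h : (leaf X).app _ x = (leaf X).app _ x') : x = x' :=
  congrArg ((cod X).app (op c)) h

theorem Graft.unique {c : C} {p : (T.monad.obj (Tree X)).obj (op c)}
    {τ r r' : (Tree X).obj (op c)} (h : Graft X p τ r) (h' : Graft X p τ r') : r = r' := by
  induction h with
  | leaf hp hτ =>
    cases h' with
    | leaf hp' hτ' =>
      exact eta_ext (cod X) (leaf_inj (hτ.trans hτ'.symm)) (hp.trans hp'.symm)
    | node t y β h B ρ hρ hB hp' hτ' hr' => exact (leaf_ne_node (hτ.trans hτ'.symm)).elim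
  | node t y β h B ρ hρ hB hp hτ hr ih =>
    cases h' with
    | leaf hp' hτ' => exact (leaf_ne_node (hτ'.trans hτ.symm)).elim
    | node t' y' β' h' B' ρ' hρ' hB' hp' hτ' hr' =>
      obtain ⟨rfl, hy, hβ⟩ := node_inj (hτ.trans hτ'.symm)
      cases hy
      cases hβ
      have hBB : B = B' := by
        refine mu_ext (cod X) ?_ (hp.trans hp'.symm)
        have e : B ≫ T.monad.map (cod X) = β ≫ dom X := hom_ext_elt fun d x => (hB d x).cond
        have e' : B' ≫ T.monad.map (cod X) = β ≫ dom X := hom_ext_elt fun d x => (hB' d x).cond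
        rw [e, e']
      subst hBB
      have : ρ = ρ' := hom_ext_elt fun d x => ih d x (hB' d x)
      subst this
      exact hr.symm.trans hr'

theorem exists_graft {c : C} (τ : (Tree X).obj (op c)) (p : (T.monad.obj (Tree X)).obj (op c))
    (hp : (T.monad.map (cod X)).app _ p = (dom X).app _ τ) : ∃ r, Graft X p τ r := by
  revert p
  refine induct (P := fun c τ => ∀ p : (T.monad.obj (Tree X)).obj (op c),
    (T.monad.map (cod X)).app _ p = (dom X).app _ τ → ∃ r, Graft X p τ r) ?_ ?_ τ
  · intro c x p hp
    obtain ⟨r, rfl, rfl⟩ := eta_lift (cod X) p x hp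
    exact ⟨r, Graft.leaf rfl rfl⟩
  · intro c t y β h ih p hp
    obtain ⟨B, hB, rfl⟩ := mu_lift (cod X) p t (β ≫ dom X) hp
    have hB' := fun d x => ih d x (B.app _ x) (app_congr hB x)
    choose ρ hρ using hB'
    let ρ' : T.arity.obj (opn t) ⟶ Tree X :=
      { app := fun d => TypeCat.ofHom fun x => ρ d.unop x
        naturality := fun d e j => by
          refine ConcreteCategory.hom_ext _ _ fun x => ?_
          have h₁ := hρ e.unop ((T.arity.obj (opn t)).map j x)
          have h₂ := (hρ d.unop x).res j.unop
          have e₁ := nat_apply B j.unop x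
          have e₂ := nat_apply β j.unop x
          rw [← e₁, ← e₂] at h₂
          exact h₁.unique h₂ }
    refine ⟨node t y ρ' ?_, Graft.node t y β h B ρ' ?_ hρ rfl rfl rfl⟩ <;>
    · rw [← h]
      exact hom_ext_elt fun d x => (hρ d x).cod_eq

variable (X)

/-- Grafting of trees. -/
noncomputable def graft : pullback (T.monad.map (cod X)) (dom X) ⟶ Tree X where
  app _ := TypeCat.ofHom fun z => (exists_graft _ _ (pb_cond z)).choose
  naturality c d i := by
    refine ConcreteCategory.hom_ext _ _ fun z => ?_
    have h₁ := (exists_graft _ _ (pb_cond ((pullback (T.monad.map (cod X)) (dom X)).map i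
      z))).choose_spec
    have h₂ := (exists_graft _ _ (pb_cond z)).choose_spec.res i.unop
    have e₁ := nat_apply (pullback.fst (T.monad.map (cod X)) (dom X)) i.unop z
    have e₂ := nat_apply (pullback.snd (T.monad.map (cod X)) (dom X)) i.unop z
    refine h₁.unique ?_
    refine Eq.mp ?_ h₂
    exact (congrArg₂ (fun a b => Graft X a b _) e₁ e₂).symm

variable {X}

theorem graft_spec {c : C} (z : (pullback (T.monad.map (cod X)) (dom X)).obj (op c)) :
    Graft X ((pullback.fst (T.monad.map (cod X)) (dom X)).app _ z)
      ((pullback.snd (T.monad.map (cod X)) (dom X)).app _ z) ((graft X).app _ z) :=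
  (exists_graft _ _ (pb_cond z)).choose_spec

/-- Associativity of grafting. -/
theorem graft_assoc {c : C} {p : (T.monad.obj (Tree X)).obj (op c)} {q s : (Tree X).obj (op c)}
    (hs : Graft X p q s)
    (P : (T.monad.obj (pullback (T.monad.map (cod X)) (dom X))).obj (op c))
    (hP : (T.monad.map (pullback.snd _ _)).app _ P = p) {z : (Tree X).obj (op c)}
    (hz : Graft X ((T.monad.μ.app _).app _ ((T.monad.map (pullback.fst _ _)).app _ P)) s z) :
    Graft X ((T.monad.map (graft X)).app _ P) q z := by
  induction hs with
  | leaf hp hτ =>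
    obtain ⟨w, hw, rfl⟩ := eta_lift _ P _ (hP.trans hp.symm)
    rw [nat_eta] at hz ⊢
    have e := app_congr (T.monad.left_unit (Tree X))
      ((pullback.fst (T.monad.map (cod X)) (dom X)).app _ w)
    have hz' := Eq.mp (congrArg (fun a => Graft X a _ z) e) hz
    rw [← hw] at hz'
    have hzw := hz'.unique (graft_spec w)
    subst hzw
    refine Graft.leaf rfl ?_
    rw [← hτ, ← hw, (graft_spec w).cod_eq]
  | node t y β h B ρ hρ hB hp hτ hr ih =>
    obtain ⟨Q, hQ, rfl⟩ := mu_lift _ P t B (hP.trans hp.symm)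
    rw [nat_mu, map_el]
    rw [nat_mu, map_el] at hz
    have e := app_congr (T.monad.assoc (Tree X)) (el t (Q ≫ T.monad.map (pullback.fst _ _)))
    have hz' := Eq.mp (congrArg (fun a => Graft X a _ z) e.symm) hz
    cases hz' with
    | leaf hp' hτ' => exact (leaf_ne_node (hτ'.trans hr.symm)).elim
    | node t' y' β' h' B' ρ' hρ' hB' hp' hτ' hr' =>
      obtain ⟨rfl, hy, hβ⟩ := node_inj (hr.trans hτ'.symm)
      cases hy
      cases hβ
      refine Graft.node t y β h (Q ≫ T.monad.map (graft X)) ρ' hρ' ?_ rfl hτ hr'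
      intro d x
      refine ih d x (Q.app _ x) (app_congr hQ x) ?_
      have hBB : B' = (Q ≫ T.monad.map (pullback.fst _ _)) ≫ T.monad.μ.app (Tree X) := by
        refine mu_ext (cod X) ?_ hp'
        have e₁ : B' ≫ T.monad.map (cod X) = ρ ≫ dom X := hom_ext_elt fun d x => (hB' d x).cond
        have e₂ : ρ ≫ dom X = (B ≫ T.monad.map (dom X)) ≫ T.monad.μ.app (cellsOf X) :=
          hom_ext_elt fun d x => (hB d x).dom_eq
        have e₃ := T.monad.μ.naturality (cod X)
        dsimp at e₃
        rw [e₁, e₂, ← hQ, Category.assoc, Category.assoc, Category.assoc, Category.assoc, ← e₃,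
          ← T.monad.map_comp_assoc, ← T.monad.map_comp_assoc, pullback.condition]
      have := hB' d x
      rw [hBB] at this
      exact this

end Tree
end FamilialMonad
end FreeMulticategories

section FreeMulticategories

namespace FamilialMonad

variable {C : Type u} [SmallCategory C] {T : FamilialMonad C} (X : T.Plusᵒᵖ ⥤ Type u)

namespace Tree

/-- Every arrow of `X` as a tree with a single node. -/
def single {c : C} {t : T.ops.obj (op c)} (y : X.obj (op (.arrow (opn t)))) :
    (Tree X).obj (op c) :=
  node t y (srcOf y ≫ leaf X) (hom_ext_elt fun _ _ => rfl)

theorem graft_ids {c : C} (τ : (Tree X).obj (op c)) :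
    Graft X ((T.monad.map (leaf X)).app _ ((dom X).app _ τ)) τ τ := by
  refine induct (P := fun c τ => Graft X ((T.monad.map (leaf X)).app _ ((dom X).app _ τ)) τ τ)
    ?_ ?_ τ
  · intro c x
    refine Graft.leaf ?_ rfl
    exact (nat_eta (leaf X) x).symm
  · intro c t y β h ih
    refine Graft.node t y β h ((β ≫ dom X) ≫ T.monad.map (leaf X)) β h ih ?_ rfl rfl
    rw [dom_node, nat_mu, map_el]

variable {X} in
theorem graft_assoc_of {c : C} (P : (T.monad.obj (pullback (T.monad.map (cod X)) (dom X))).obj (op c))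
    (q : (Tree X).obj (op c)) (L M R : (pullback (T.monad.map (cod X)) (dom X)).obj (op c))
    (hL₁ : (pullback.fst (T.monad.map (cod X)) (dom X)).app _ L = (T.monad.map (graft X)).app _ P)
    (hL₂ : (pullback.snd (T.monad.map (cod X)) (dom X)).app _ L = q)
    (hM₁ : (pullback.fst (T.monad.map (cod X)) (dom X)).app _ M =
      (T.monad.map (pullback.snd _ _)).app _ P)
    (hM₂ : (pullback.snd (T.monad.map (cod X)) (dom X)).app _ M = q)
    (hR₁ : (pullback.fst (T.monad.map (cod X)) (dom X)).app _ R =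
      (T.monad.μ.app _).app _ ((T.monad.map (pullback.fst _ _)).app _ P))
    (hR₂ : (pullback.snd (T.monad.map (cod X)) (dom X)).app _ R = (graft X).app _ M) :
    (graft X).app _ L = (graft X).app _ R := by
  have hL := graft_spec L
  have hM := graft_spec M
  have hR := graft_spec R
  rw [hL₁, hL₂] at hL
  rw [hM₁, hM₂] at hM
  rw [hR₁, hR₂] at hR
  exact hL.unique (graft_assoc hM P rfl hR)

end Tree

open EnrichedAlgebras.FamilialMonad.Tree

/-- The free `T`-multicategory on a presheaf on `C⁺`. -/
noncomputable def freeMulticat : Multicat T.monad where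
  cells := cellsOf X
  arrows := Tree X
  dom := Tree.dom X
  cod := Tree.cod X
  ids := Tree.leaf X
  ids_dom := hom_ext_elt fun _ _ => rfl
  ids_cod := hom_ext_elt fun _ _ => rfl
  comp := graft X
  comp_dom := hom_ext_elt fun _ z => (graft_spec z).dom_eq
  comp_cod := hom_ext_elt fun _ z => (graft_spec z).cod_eq
  ids_comp := by
    refine hom_ext_elt fun c τ => ?_
    let z := (pullback.lift (Tree.dom X ≫ T.monad.map (Tree.leaf X)) (𝟙 (Tree X)) (by
      rw [Category.assoc, ← T.monad.map_comp,
        show Tree.leaf X ≫ Tree.cod X = 𝟙 _ from hom_ext_elt fun _ _ => rfl]; simp) :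
      Tree X ⟶ pullback (T.monad.map (Tree.cod X)) (Tree.dom X)).app _ τ
    have h := graft_spec z
    have h₁ : (pullback.fst (T.monad.map (Tree.cod X)) (Tree.dom X)).app _ z =
      (T.monad.map (leaf X)).app _ ((dom X).app _ τ) := app_congr (pullback.lift_fst _ _ _) τ
    have h₂ : (pullback.snd (T.monad.map (Tree.cod X)) (Tree.dom X)).app _ z = τ :=
      app_congr (pullback.lift_snd _ _ _) τ
    rw [h₁, h₂] at h
    exact h.unique (graft_ids X τ)
  comp_ids := by
    refine hom_ext_elt fun c τ => ?_
    let z := (pullback.lift (T.monad.η.app (Tree X)) (Tree.cod X ≫ Tree.leaf X) (by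
      rw [Category.assoc, show Tree.leaf X ≫ Tree.dom X = T.monad.η.app _ from
        hom_ext_elt fun _ _ => rfl]; exact (T.monad.η.naturality (Tree.cod X)).symm) :
      Tree X ⟶ pullback (T.monad.map (Tree.cod X)) (Tree.dom X)).app _ τ
    have h := graft_spec z
    have h₁ : (pullback.fst (T.monad.map (Tree.cod X)) (Tree.dom X)).app _ z =
      (T.monad.η.app (Tree X)).app _ τ := app_congr (pullback.lift_fst _ _ _) τ
    have h₂ : (pullback.snd (T.monad.map (Tree.cod X)) (Tree.dom X)).app _ z =
      (leaf X).app _ ((cod X).app _ τ) := app_congr (pullback.lift_snd _ _ _) τ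
    rw [h₁, h₂] at h
    exact h.unique (Graft.leaf rfl rfl)
  comp_assoc := by
    refine hom_ext_elt fun c z => ?_
    let F := pullback.fst (T.monad.map (pullback.snd (T.monad.map (Tree.cod X)) (Tree.dom X) ≫
      Tree.cod X)) (Tree.dom X)
    let S := pullback.snd (T.monad.map (pullback.snd (T.monad.map (Tree.cod X)) (Tree.dom X) ≫
      Tree.cod X)) (Tree.dom X)
    let M : pullback _ _ ⟶ pullback _ _ := pullback.lift (f := T.monad.map (Tree.cod X))
      (g := Tree.dom X)
      (F ≫ T.monad.map (pullback.snd (T.monad.map (Tree.cod X)) (Tree.dom X))) S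
      (by rw [Category.assoc, ← T.monad.map_comp, pullback.condition])
    have e : ∀ {Z : Cᵒᵖ ⥤ Type u} (f : Z ⟶ pullback (T.monad.map (Tree.cod X)) (Tree.dom X))
      (w : Z.obj (op c)), (f ≫ graft X).app _ w = (graft X).app _ (f.app _ w) := fun _ _ => rfl
    rw [e, e]
    refine graft_assoc_of (F.app _ z) (S.app _ z) _ (M.app _ z) _ ?_ ?_ ?_ ?_ ?_ ?_
    · exact (app_congr (pullback.lift_fst _ _ _) z).trans rfl
    · exact (app_congr (pullback.lift_snd _ _ _) z).trans rfl
    · exact (app_congr (pullback.lift_fst _ _ _) z).trans rfl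
    · exact (app_congr (pullback.lift_snd _ _ _) z).trans rfl
    · exact (app_congr (pullback.lift_fst _ _ _) z).trans rfl
    · exact (app_congr (pullback.lift_snd _ _ _) z).trans rfl

end FamilialMonad
end FreeMulticategories

section Folding

namespace FamilialMonad

variable {C : Type u} [SmallCategory C] {T : FamilialMonad C} {X : T.Plusᵒᵖ ⥤ Type u}
  {W : Multicat T.monad} (g : X ⟶ T.graphPresheaf.obj W.toTGraph)

/-- The part on cells of a map from `X` to a `T`-multicategory. -/
def onCell : cellsOf X ⟶ W.cells where
  app c := g.app (op (.cell c.unop))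
  naturality _ _ i := g.naturality (Quiver.Hom.op (X := Plus.cell _) (Y := Plus.cell _)
    (PlusHom.cell i.unop))

/-- The part on arrows of a map from `X` to a `T`-multicategory. -/
def onArrow {c : C} {t : T.ops.obj (op c)} (y : X.obj (op (.arrow (opn t)))) :
    W.arrows.obj (op c) :=
  (g.app (op (.arrow (opn t))) y).1.1

theorem onArrow_src {c : C} {t : T.ops.obj (op c)} (y : X.obj (op (.arrow (opn t)))) :
    srcOf y ≫ onCell g = (g.app (op (.arrow (opn t))) y).1.2 := by
  refine hom_ext_elt fun d x => ?_
  exact NatTrans.naturality_apply g (Quiver.Hom.op (X := Plus.cell d) (Y := Plus.arrow (opn t))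
    (PlusHom.source x)) y

theorem dom_onArrow {c : C} {t : T.ops.obj (op c)} (y : X.obj (op (.arrow (opn t)))) :
    W.dom.app _ (onArrow g y) = el t (srcOf y ≫ onCell g) := by
  rw [onArrow_src]
  exact (g.app (op (.arrow (opn t))) y).2

theorem cod_onArrow {c : C} {t : T.ops.obj (op c)} (y : X.obj (op (.arrow (opn t)))) :
    W.cod.app _ (onArrow g y) = (onCell g).app _ (tgtOf y) := by
  refine Eq.trans ?_ (NatTrans.naturality_apply g (Quiver.Hom.op (X := Plus.cell c)
    (Y := Plus.arrow (opn t)) (PlusHom.target (𝟙 _))) y).symm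
  exact (congrArg (fun m => (ConcreteCategory.hom m) (W.cod.app (op c) (onArrow g y)))
    (W.cells.map_id (op c))).symm

theorem onArrow_res {c d : C} (i : d ⟶ c) {t : T.ops.obj (op c)}
    (y : X.obj (op (.arrow (opn t)))) :
    W.arrows.map i.op (onArrow g y) = onArrow g (faceOf (resHom i t) y) :=
  congrArg (fun z => z.1.1) (NatTrans.naturality_apply g (Quiver.Hom.op
    (X := Plus.arrow (opn (T.ops.map i.op t))) (Y := Plus.arrow (opn t))
    (PlusHom.face (resHom i t))) y).symm

namespace Tree

/-- `Fold g τ w` says that `w` is the composite of the diagram `τ` of arrows mapped by `g`. -/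
inductive Fold : ∀ {c : C}, (Tree X).obj (op c) → W.arrows.obj (op c) → Prop
  | leaf {c : C} {τ : (Tree X).obj (op c)} {w : W.arrows.obj (op c)}
      (x : (cellsOf X).obj (op c)) (hτ : (leaf X).app _ x = τ)
      (hw : W.ids.app _ ((onCell g).app _ x) = w) : Fold τ w
  | node {c : C} {τ : (Tree X).obj (op c)} {w : W.arrows.obj (op c)}
      (t : T.ops.obj (op c)) (y : X.obj (op (.arrow (opn t))))
      (β : T.arity.obj (opn t) ⟶ Tree X) (h : β ≫ cod X = srcOf y)
      (φ : T.arity.obj (opn t) ⟶ W.arrows)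
      (hφ : (T.monad.map W.cod).app _ (el t φ) = W.dom.app _ (onArrow g y))
      (hβ : ∀ (d : C) (x : (T.arity.obj (opn t)).obj (op d)), Fold (β.app _ x) (φ.app _ x))
      (hτ : node t y β h = τ) (hw : W.compose (el t φ) (onArrow g y) hφ = w) : Fold τ w

theorem graft_pbElt {c : C} (p : (T.monad.obj (Tree X)).obj (op c)) (q : (Tree X).obj (op c))
    (h : (T.monad.map (cod X)).app _ p = (dom X).app _ q) :
    Graft X p q ((graft X).app _ (pbElt _ _ p q h)) := by
  refine cast ?_ (graft_spec (pbElt _ _ p q h))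
  exact congrArg₂ (fun a b => Graft X a b _) (pbElt_fst _ _ h) (pbElt_snd _ _ h)

variable {g}

theorem Fold.cod_eq {c : C} {τ : (Tree X).obj (op c)} {w : W.arrows.obj (op c)}
    (h : Fold g τ w) : W.cod.app _ w = (onCell g).app _ ((cod X).app _ τ) := by
  cases h with
  | leaf x hτ hw =>
    rw [← hτ, ← hw]
    exact app_congr W.ids_cod _
  | node t y β h φ hφ hβ hτ hw =>
    rw [← hτ, ← hw, Multicat.cod_compose, cod_onArrow, cod_node]

theorem Fold.dom_eq {c : C} {τ : (Tree X).obj (op c)} {w : W.arrows.obj (op c)}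
    (h : Fold g τ w) :
    W.dom.app _ w = (T.monad.map (onCell g)).app _ ((dom X).app _ τ) := by
  induction h with
  | leaf x hτ hw =>
    rw [← hτ, ← hw]
    exact (app_congr W.ids_dom _).trans (nat_eta (onCell g) x).symm
  | node t y β h φ hφ hβ hτ hw ih =>
    rw [← hτ, ← hw, Multicat.dom_compose, dom_node, nat_mu, map_el, map_el]
    congr 2
    exact hom_ext_elt ih

theorem Fold.res {c d : C} (i : d ⟶ c) {τ : (Tree X).obj (op c)} {w : W.arrows.obj (op c)}
    (h : Fold g τ w) : Fold g ((Tree X).map i.op τ) (W.arrows.map i.op w) := by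
  cases h with
  | leaf x hτ hw =>
    refine Fold.leaf ((cellsOf X).map i.op x) ?_ ?_
    · rw [← hτ, nat_apply]
    · rw [← hw, nat_apply, nat_apply]
  | node t y β h φ hφ hβ hτ hw =>
    rw [← hτ, ← hw, res_node, Multicat.res_compose]
    refine Fold.node _ _ _ _ (T.arity.map (resHom i t) ≫ φ) ?_ (fun d x => hβ d _) rfl ?_
    · rw [← onArrow_res, ← res_el, nat_apply, hφ, nat_apply]
    · exact W.compose_congr _ rfl (onArrow_res g i y).symm

theorem Fold.unique {c : C} {τ : (Tree X).obj (op c)} {w w' : W.arrows.obj (op c)}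
    (h : Fold g τ w) (h' : Fold g τ w') : w = w' := by
  induction h with
  | leaf x hτ hw =>
    cases h' with
    | leaf x' hτ' hw' =>
      have := leaf_inj (hτ.trans hτ'.symm)
      subst this
      exact hw.symm.trans hw'
    | node t y β h φ hφ hβ hτ' hw' => exact (leaf_ne_node (hτ.trans hτ'.symm)).elim
  | node t y β h φ hφ hβ hτ hw ih =>
    cases h' with
    | leaf x' hτ' hw' => exact (leaf_ne_node (hτ'.trans hτ.symm)).elim
    | node t' y' β' h' φ' hφ' hβ' hτ' hw' =>
      obtain ⟨rfl, hy, hb⟩ := node_inj (hτ.trans hτ'.symm)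
      cases hy
      cases hb
      have : φ = φ' := hom_ext_elt fun d x => ih d x (hβ' d x)
      subst this
      exact hw.symm.trans hw'

variable (g)

theorem exists_fold {c : C} (τ : (Tree X).obj (op c)) : ∃ w, Fold g τ w := by
  refine induct (P := fun c τ => ∃ w, Fold g τ w) ?_ ?_ τ
  · intro c x
    exact ⟨_, Fold.leaf x rfl rfl⟩
  · intro c t y β h ih
    choose φ hφ using ih
    let φ' : T.arity.obj (opn t) ⟶ W.arrows :=
      { app := fun d => TypeCat.ofHom fun x => φ d.unop x
        naturality := fun d e j => by
          refine ConcreteCategory.hom_ext _ _ fun x => ?_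
          have h₁ := hφ e.unop ((T.arity.obj (opn t)).map j x)
          have h₂ := (hφ d.unop x).res j.unop
          have e₁ := nat_apply β j.unop x
          rw [← e₁] at h₂
          exact h₁.unique h₂ }
    refine ⟨_, Fold.node t y β h φ' ?_ hφ rfl rfl⟩
    rw [dom_onArrow, map_el, ← h]
    congr 1
    exact hom_ext_elt fun d x => (hφ d x).cod_eq

/-- Composition of the diagrams of arrows of `X` mapped by `g`. -/
noncomputable def fold : Tree X ⟶ W.arrows where
  app _ := TypeCat.ofHom fun τ => (exists_fold g τ).choose
  naturality c d i := by
    refine ConcreteCategory.hom_ext _ _ fun τ => ?_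
    exact (exists_fold g ((Tree X).map i τ)).choose_spec.unique
      ((exists_fold g τ).choose_spec.res i.unop)

theorem fold_spec {c : C} (τ : (Tree X).obj (op c)) : Fold g τ ((fold g).app _ τ) :=
  (exists_fold g τ).choose_spec

theorem fold_leaf {c : C} (x : (cellsOf X).obj (op c)) :
    (fold g).app _ ((leaf X).app _ x) = W.ids.app _ ((onCell g).app _ x) :=
  (fold_spec g _).unique (Fold.leaf x rfl rfl)

theorem fold_cod : fold g ≫ W.cod = cod X ≫ onCell g :=
  hom_ext_elt fun _ τ => (fold_spec g τ).cod_eq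

theorem fold_dom : fold g ≫ W.dom = dom X ≫ T.monad.map (onCell g) :=
  hom_ext_elt fun _ τ => (fold_spec g τ).dom_eq

theorem fold_node_cond {c : C} (t : T.ops.obj (op c)) (y : X.obj (op (.arrow (opn t))))
    (β : T.arity.obj (opn t) ⟶ Tree X) (h : β ≫ cod X = srcOf y) :
    (T.monad.map W.cod).app _ (el t (β ≫ fold g)) = W.dom.app _ (onArrow g y) := by
  rw [dom_onArrow, map_el, Category.assoc, fold_cod, ← h, Category.assoc]

theorem fold_node {c : C} (t : T.ops.obj (op c)) (y : X.obj (op (.arrow (opn t))))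
    (β : T.arity.obj (opn t) ⟶ Tree X) (h : β ≫ cod X = srcOf y) :
    (fold g).app _ (node t y β h) =
      W.compose (el t (β ≫ fold g)) (onArrow g y) (fold_node_cond g t y β h) :=
  (fold_spec g _).unique (Fold.node t y β h (β ≫ fold g) _ (fun _ _ => fold_spec g _) rfl rfl)

theorem fold_graft {c : C} {p : (T.monad.obj (Tree X)).obj (op c)} {τ r : (Tree X).obj (op c)}
    (h : Graft X p τ r)
    (hp : (T.monad.map W.cod).app _ ((T.monad.map (fold g)).app _ p) =
      W.dom.app _ ((fold g).app _ τ)) :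
    (fold g).app _ r = W.compose ((T.monad.map (fold g)).app _ p) ((fold g).app _ τ) hp := by
  induction h with
  | @leaf c p τ r hp' hτ =>
    have e₁ : (T.monad.map (fold g)).app _ p = (T.monad.η.app _).app _ ((fold g).app _ r) := by
      rw [← hp', nat_eta]
    have e₂ : (fold g).app _ τ = W.ids.app _ (W.cod.app _ ((fold g).app _ r)) := by
      rw [← hτ, fold_leaf, (fold_spec g r).cod_eq]
    rw [W.compose_congr _ e₁ e₂, W.compose_ids]
  | @node c p τ r t y β h B ρ hρ hB hp' hτ hr ih =>
    have hΦ : (B ≫ T.monad.map (fold g)) ≫ T.monad.map W.cod = (β ≫ fold g) ≫ W.dom := by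
      have e : B ≫ T.monad.map (cod X) = β ≫ dom X := hom_ext_elt fun d x => (hB d x).cond
      rw [Category.assoc, Category.assoc, fold_dom, ← T.monad.map_comp, fold_cod,
        T.monad.map_comp, reassoc_of% e]
    let Φ : T.arity.obj (opn t) ⟶ W.pairs := pullback.lift _ _ hΦ
    have hΦ₁ : Φ ≫ W.pfst = B ≫ T.monad.map (fold g) := pullback.lift_fst _ _ _
    have hΦ₂ : Φ ≫ W.psnd = β ≫ fold g := pullback.lift_snd _ _ _
    have hρΦ : ρ ≫ fold g = Φ ≫ W.comp := by
      refine hom_ext_elt fun d x => ?_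
      have k₁ := app_congr hΦ₁ x
      have k₂ := app_congr hΦ₂ x
      refine (ih d x (app_congr hΦ x)).trans ?_
      refine (W.compose_congr _ k₁.symm k₂.symm).trans (W.compose_pair (Φ.app _ x))
    have a₁ : (T.monad.map W.psnd).app _ (el t Φ) = el t (β ≫ fold g) := by rw [map_el, hΦ₂]
    have a₂ : (T.monad.map W.comp).app _ (el t Φ) = el t (ρ ≫ fold g) := by rw [map_el, hρΦ]
    have a₃ : (T.monad.μ.app _).app _ ((T.monad.map W.pfst).app _ (el t Φ)) =
        (T.monad.map (fold g)).app _ p := by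
      rw [← hp', map_el, hΦ₁, nat_mu, map_el]
    have b₂ := fold_node g t y β h
    rw [hτ] at b₂
    have c₁ : (T.monad.map W.cod).app _ ((T.monad.map W.psnd).app _ (el t Φ)) =
        W.dom.app _ (onArrow g y) := by rw [a₁]; exact fold_node_cond g t y β h
    have c₂ : (T.monad.map W.cod).app _ ((T.monad.map W.comp).app _ (el t Φ)) =
        W.dom.app _ (onArrow g y) := by rw [a₂]; exact fold_node_cond g t y ρ hρ
    have d₁ : W.compose _ _ c₁ = (fold g).app _ τ := (W.compose_congr c₁ a₁ rfl).trans b₂.symm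
    have H := W.compose_assoc (el t Φ) (onArrow g y) c₁ c₂ (by rw [a₃, d₁]; exact hp)
    rw [← hr, fold_node]
    refine (W.compose_congr _ a₂.symm rfl).trans (H.trans ?_)
    exact W.compose_congr _ a₃ d₁

/-- The `T`-multifunctor from the free `T`-multicategory induced by a map to a
`T`-multicategory. -/
noncomputable def foldHom : freeMulticat X ⟶ W where
  onCells := onCell g
  onArrows := fold g
  dom_comm := fold_dom g
  cod_comm := fold_cod g
  map_ids := hom_ext_elt fun _ x => fold_leaf g x
  map_comp := by
    refine Multicat.map_comp_of (V := freeMulticat X) (W := W)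
      ⟨onCell g, fold g, fold_dom g, fold_cod g⟩ ?_
    intro c p q hpq hpq'
    exact fold_graft g (graft_pbElt p q hpq) hpq'

end Tree

open EnrichedAlgebras.FamilialMonad.Tree

theorem single_dom {c : C} {t : T.ops.obj (op c)} (y : X.obj (op (.arrow (opn t)))) :
    (Tree.dom X).app _ (single X y) = el t (srcOf y) := by
  have e : (srcOf y ≫ Tree.leaf X) ≫ Tree.dom X = srcOf y ≫ T.monad.η.app (cellsOf X) :=
    hom_ext_elt fun _ _ => rfl
  rw [single, dom_node, e, ← map_el]
  exact app_congr (T.monad.right_unit (cellsOf X)) (el t (srcOf y))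

theorem single_face {s t : T.Op} (k : s ⟶ t) (y : X.obj (op (.arrow t))) :
    single X (t := s.unop.2) (faceOf k y) =
      (Tree X).map (T.shapeMap k).op (single X (t := t.unop.2) y) := by
  obtain ⟨⟨c, s⟩⟩ := s
  obtain ⟨⟨d, t⟩⟩ := t
  obtain ⟨⟨i, hi⟩⟩ := k
  change d ⟶ c at i
  change T.ops.map i t = s at hi
  subst hi
  refine Eq.trans ?_ (res_node (resHom i.unop t).unop.1.unop t y _ _).symm
  rw [single]
  congr 1
  rw [← Category.assoc, ← srcOf_faceOf]
  rfl

variable (X)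

/-- The inclusion of `X` in the free `T`-multicategory on it. -/
def freeUnit : X ⟶ (Multicat.graph T.monad ⋙ T.graphPresheaf).obj (freeMulticat X) where
  app e := match e with
    | op (.cell c) => 𝟙 (X.obj (op (.cell c)))
    | op (.arrow t) => TypeCat.ofHom fun y =>
        ⟨(single X (t := t.unop.2) y, srcOf y), single_dom (t := t.unop.2) y⟩
  naturality e e' f := match e, e', f with
    | op (.cell _), op (.cell _), ⟨.cell i⟩ => rfl
    | op (.arrow _), op (.arrow _), ⟨.face k⟩ => by
        refine ConcreteCategory.hom_ext _ _ fun y => Subtype.ext (Prod.ext ?_ ?_)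
        · exact single_face k y
        · exact srcOf_faceOf k y
    | op (.arrow t), op (.cell d), ⟨.target i⟩ => by
        refine ConcreteCategory.hom_ext _ _ fun y => ?_
        have h := congrArg (fun m => (ConcreteCategory.hom m) y) (X.map_comp
          (Quiver.Hom.op (X := Plus.cell (T.shape t)) (Y := Plus.arrow t) (PlusHom.target (𝟙 _)))
          (Quiver.Hom.op (X := Plus.cell d) (Y := Plus.cell (T.shape t)) (PlusHom.cell i)))
        refine Eq.trans ?_ h
        refine congrArg (fun m => (ConcreteCategory.hom (X.map m)) y) ?_
        exact congrArg (fun j => Quiver.Hom.op (X := Plus.cell d) (Y := Plus.arrow t)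
          (PlusHom.target j)) (Category.comp_id i).symm
    | op (.arrow _), op (.cell _), ⟨.source x⟩ => rfl

variable {X}

theorem graft_single {c : C} (t : T.ops.obj (op c)) (y : X.obj (op (.arrow (opn t))))
    (β : T.arity.obj (opn t) ⟶ Tree X) (h : β ≫ Tree.cod X = srcOf y) :
    Graft X (el t β) (single X y) (node t y β h) := by
  refine Graft.node t y _ _ (β ≫ T.monad.η.app (Tree X)) β h ?_ ?_ rfl rfl
  · intro d x
    exact Graft.leaf rfl (congrArg ((Tree.leaf X).app (op d)) (app_congr h x))
  · rw [← map_el]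
    exact app_congr (T.monad.right_unit (Tree X)) (el t β)

theorem fold_single {c : C} {t : T.ops.obj (op c)} (y : X.obj (op (.arrow (opn t)))) :
    (fold g).app _ (single X y) = onArrow g y := by
  refine (fold_node g t y (srcOf y ≫ Tree.leaf X) (hom_ext_elt fun _ _ => rfl)).trans ?_
  have e : el t ((srcOf y ≫ Tree.leaf X) ≫ fold g) =
      (T.monad.map W.ids).app _ (W.dom.app _ (onArrow g y)) := by
    rw [dom_onArrow, map_el]
    congr 1
    exact hom_ext_elt fun d x => fold_leaf g _
  rw [W.compose_congr _ e rfl]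
  exact W.ids_compose _ _

theorem unit_foldHom :
    freeUnit X ≫ (Multicat.graph T.monad ⋙ T.graphPresheaf).map (foldHom g) = g := by
  refine NatTrans.ext (funext fun e => ConcreteCategory.hom_ext _ _ fun y => ?_)
  match e with
  | op (.cell c) => rfl
  | op (.arrow t) =>
    exact Subtype.ext (Prod.ext (fold_single g (t := t.unop.2) y)
      (onArrow_src g (t := t.unop.2) y))

theorem foldHom_unit (f : freeMulticat X ⟶ W) :
    foldHom (freeUnit X ≫ (Multicat.graph T.monad ⋙ T.graphPresheaf).map f) = f := by
  have h₀ : onCell (freeUnit X ≫ (Multicat.graph T.monad ⋙ T.graphPresheaf).map f) = f.onCells :=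
    hom_ext_elt fun _ _ => rfl
  refine Multicat.hom_ext h₀ (hom_ext_elt fun c τ => ?_)
  refine (fold_spec _ τ).unique ?_
  refine induct (P := fun c τ => Fold (freeUnit X ≫
    (Multicat.graph T.monad ⋙ T.graphPresheaf).map f) τ (f.onArrows.app (op c) τ)) ?_ ?_ τ
  · intro c x
    exact Fold.leaf x rfl (app_congr f.map_ids x).symm
  · intro c t y β h ih
    let F : Tree X ⟶ W.arrows := f.onArrows
    let G : cellsOf X ⟶ W.cells := f.onCells
    have hF₀ : F ≫ W.cod = Tree.cod X ≫ G := f.cod_comm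
    have hF₁ : F ≫ W.dom = Tree.dom X ≫ T.monad.map G := f.dom_comm
    have h₁ : (T.monad.map (Tree.cod X)).app _ (el t β) = (Tree.dom X).app _ (single X y) := by
      rw [single_dom, map_el, h]
    have h₂ : (T.monad.map W.cod).app _ (el t (β ≫ F)) =
        W.dom.app _ (F.app _ (single X y)) := by
      refine Eq.trans ?_ (app_congr hF₁ (single X y)).symm
      refine Eq.trans ?_ (congrArg ((T.monad.map G).app (op c)) h₁)
      rw [map_el, map_el, map_el, Category.assoc, Category.assoc, hF₀]
    refine Fold.node t y β h (β ≫ F) h₂ ih rfl ?_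
    refine (Multicat.onArrows_compose f (el t β) (single X y) h₁ h₂).symm.trans ?_
    refine congrArg (F.app (op c)) ?_
    exact (graft_pbElt (el t β) (single X y) h₁).unique (graft_single t y β h)

variable (T)

/-- Free `T`-multicategories on presheaves on `C⁺`. -/
noncomputable def freeAdj :
    Adjunction.leftAdjointOfEquiv (G := Multicat.graph T.monad ⋙ T.graphPresheaf)
      (F_obj := fun X => freeMulticat X)
      (fun X W => 
        { toFun := fun f => freeUnit X ≫ (Multicat.graph T.monad ⋙ T.graphPresheaf).map f
          invFun := fun g => foldHom (W := W) g
          left_inv := foldHom_unit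
          right_inv := fun g => unit_foldHom (W := W) g })
      (fun X W W' g h => by simp) ⊣ Multicat.graph T.monad ⋙ T.graphPresheaf :=
  Adjunction.adjunctionOfEquivLeft _ _

/-- The monad `T⁺`, whose algebras are the `T`-multicategories. -/
noncomputable def plus : Monad (T.Plusᵒᵖ ⥤ Type u) := T.freeAdj.toMonad

end FamilialMonad
end Folding

section Transport

variable {E F : Type*} [Category* E] [Category* F] {L : F ⥤ E} {R : E ⥤ F} {S : F ⥤ E}

/-- The transport of a monad `T` along an adjunction `L ⊣ R`: the monad of the composite of this
adjunction with the one between `T`-algebras and the base. Its functor part is `R T L`. -/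
def transport (adj : L ⊣ R) (T : Monad E) : Monad F :=
  (adj.comp T.adj).toMonad

variable (adj : L ⊣ R) (adj' : R ⊣ S) (T : Monad E)

/-- The comparison `R T L R X ⟶ R T X`. -/
def transportMap (X : E) : (transport adj T).obj (R.obj X) ⟶ R.obj (T.obj X) :=
  R.map (T.map (adj.counit.app X))

theorem transportMap_nat {X Y : E} (f : X ⟶ Y) :
    transportMap adj T X ≫ R.map (T.map f) =
      (transport adj T).map (R.map f) ≫ transportMap adj T Y := by
  have h := adj.counit.naturality f
  dsimp at h
  change R.map _ ≫ _ = R.map (T.map (L.map (R.map f))) ≫ R.map _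
  rw [← R.map_comp, ← R.map_comp]
  congr 1
  exact (T.map_comp _ _).symm.trans ((congrArg (fun k => T.map k) h.symm).trans (T.map_comp _ _))

theorem transportMap_eta (X : E) :
    (transport adj T).η.app (R.obj X) ≫ transportMap adj T X = R.map (T.η.app X) := by
  have h := T.η.naturality (adj.counit.app X)
  dsimp at h
  change (adj.comp T.adj).unit.app (R.obj X) ≫ R.map (T.map (adj.counit.app X)) = _
  have h₀ : T.adj.unit.app (L.obj (R.obj X)) = T.η.app (L.obj (R.obj X)) := by
    simp only [Monad.adj, Adjunction.mkOfHomEquiv_unit_app]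
    exact Category.comp_id _
  have h₁ : R.map (T.adj.unit.app (L.obj (R.obj X))) ≫ R.map (T.map (adj.counit.app X)) =
      R.map (adj.counit.app X) ≫ R.map (T.η.app X) := by
    rw [h₀]
    exact (R.map_comp _ _).symm.trans ((congrArg R.map h.symm).trans (R.map_comp _ _))
  rw [Adjunction.comp_unit_app, Category.assoc]
  refine (congrArg (adj.unit.app (R.obj X) ≫ ·) h₁).trans ?_
  exact Adjunction.right_triangle_components_assoc adj X _

theorem transport_mu (Z : F) : (transport adj T).μ.app Z =
    R.map (T.map (adj.counit.app (T.obj (L.obj Z))) ≫ T.μ.app (L.obj Z)) := by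
  change R.map (((adj.comp T.adj).counit.app (T.free.obj (L.obj Z))).f) = _
  have h₀ : (T.adj.counit.app (T.free.obj (L.obj Z))).f = T.μ.app (L.obj Z) := by
    simp [Monad.adj]
    exact Category.id_comp _
  rw [Adjunction.comp_counit_app]
  exact congrArg (fun k => R.map (T.map (adj.counit.app (T.obj (L.obj Z))) ≫ k)) h₀

theorem transportMap_mu (X : E) :
    (transport adj T).μ.app (R.obj X) ≫ transportMap adj T X =
      (transport adj T).map (transportMap adj T X) ≫ transportMap adj T (T.obj X) ≫
        R.map (T.μ.app X) := by
  have h := T.μ.naturality (adj.counit.app X)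
  have h' := adj.counit.naturality (T.map (adj.counit.app X))
  dsimp at h h'
  rw [transport_mu]
  change R.map _ ≫ R.map _ = R.map (T.map (L.map (R.map _))) ≫ R.map (T.map _) ≫ _
  rw [← R.map_comp, ← R.map_comp, ← R.map_comp, Category.assoc, ← h]
  congr 1
  rw [← T.map_comp_assoc, ← T.map_comp_assoc]
  exact congrArg (fun k => T.map k ≫ _) h'.symm

variable {T}

variable (hT : ∀ X, IsIso (transportMap adj T X))

/-- The transpose of the algebra structure on `S Y`. -/
noncomputable def pushPre (Y : (transport adj T).Algebra) : R.obj (T.obj (S.obj Y.A)) ⟶ Y.A :=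
  have := hT (S.obj Y.A)
  inv (transportMap adj T (S.obj Y.A)) ≫ (transport adj T).map (adj'.counit.app Y.A) ≫ Y.a

theorem map_pushPre (Y : (transport adj T).Algebra) :
    transportMap adj T (S.obj Y.A) ≫ pushPre adj adj' hT Y =
      (transport adj T).map (adj'.counit.app Y.A) ≫ Y.a := by
  have := hT (S.obj Y.A)
  exact IsIso.hom_inv_id_assoc _ _

/-- Lifting `S` to algebras: the structure map `T S Y ⟶ S Y` is the transpose of
`R T S Y ≅ R T L R S Y ⟶ R T L Y ⟶ Y`. -/
noncomputable def pushAlg (Y : (transport adj T).Algebra) : T.Algebra where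
  A := S.obj Y.A
  a := adj'.homEquiv _ _ (pushPre adj adj' hT Y)
  unit := by
    apply (adj'.homEquiv _ _).symm.injective
    rw [Adjunction.homEquiv_naturality_left_symm, Equiv.symm_apply_apply,
      ← transportMap_eta adj T, Category.assoc, map_pushPre]
    have h := (transport adj T).η.naturality (adj'.counit.app Y.A)
    dsimp at h
    rw [← reassoc_of% h, Y.unit, Adjunction.homEquiv_counit]
    simp
  assoc := by
    apply (adj'.homEquiv _ _).symm.injective
    rw [Adjunction.homEquiv_naturality_left_symm, Adjunction.homEquiv_naturality_left_symm,
      Equiv.symm_apply_apply]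
    have := hT (S.obj Y.A)
    have := hT (T.obj (S.obj Y.A))
    rw [← cancel_epi (transportMap adj T (T.obj (S.obj Y.A))),
      ← cancel_epi ((transport adj T).map (transportMap adj T (S.obj Y.A)))]
    have h₁ := transportMap_mu adj T (S.obj Y.A)
    have h₂ : R.map (adj'.homEquiv _ _ (pushPre adj adj' hT Y)) ≫ adj'.counit.app Y.A =
        pushPre adj adj' hT Y := by
      exact (adj'.homEquiv_counit _ _ _).symm.trans (Equiv.symm_apply_apply _ _)
    have h₄ : (transport adj T).map (R.map (adj'.homEquiv _ _ (pushPre adj adj' hT Y))) ≫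
        (transport adj T).map (adj'.counit.app Y.A) =
          (transport adj T).map (pushPre adj adj' hT Y) :=
      ((transport adj T).map_comp _ _).symm.trans (congrArg (transport adj T).map h₂)
    rw [← reassoc_of% h₁, map_pushPre, ← Category.assoc (transportMap adj T (T.obj _)),
      transportMap_nat, Category.assoc, map_pushPre, reassoc_of% h₄,
      ← Functor.map_comp_assoc, map_pushPre, Functor.map_comp_assoc, ← Y.assoc]
    have h₃ := (transport adj T).μ.naturality (adj'.counit.app Y.A)
    dsimp at h₃
    rw [← reassoc_of% h₃]

/-- `S` as a functor between categories of algebras. -/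
noncomputable def pushAlgFunctor : (transport adj T).Algebra ⥤ T.Algebra where
  obj Y := pushAlg adj adj' hT Y
  map {Y Z} f :=
    { f := S.map f.f
      h := by
        change T.map (S.map f.f) ≫ adj'.homEquiv _ _ (pushPre adj adj' hT Z) =
          adj'.homEquiv _ _ (pushPre adj adj' hT Y) ≫ S.map f.f
        rw [← Adjunction.homEquiv_naturality_left, ← Adjunction.homEquiv_naturality_right]
        congr 1
        have := hT (S.obj Y.A)
        have h₁ : (transport adj T).map (R.map (S.map f.f)) ≫
            (transport adj T).map (adj'.counit.app Z.A) =
              (transport adj T).map (adj'.counit.app Y.A) ≫ (transport adj T).map f.f :=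
          ((transport adj T).map_comp _ _).symm.trans ((congrArg (transport adj T).map
            (adj'.counit_naturality f.f)).trans ((transport adj T).map_comp _ _))
        rw [← cancel_epi (transportMap adj T (S.obj Y.A)), ← Category.assoc, transportMap_nat,
          Category.assoc, map_pushPre, ← Category.assoc _ _ f.f, map_pushPre, Category.assoc,
          ← f.h, reassoc_of% h₁] }
  map_id Y := Monad.Algebra.Hom.ext (S.map_id _)
  map_comp f g := Monad.Algebra.Hom.ext (S.map_comp _ _)

end Transport

section Restriction

variable {D C : Type u} [SmallCategory D] [SmallCategory C]

/-- A restriction of cell shapes: `u` is the inclusion of a full subcategory which, with any object,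
contains the sources of all maps to it. -/
structure IsRestriction (u : D ⥤ C) : Prop where
  full : u.Full
  faithful : u.Faithful
  injective : Function.Injective u.obj
  downward : ∀ {c : C} {d : D}, (c ⟶ u.obj d) → ∃ e : D, u.obj e = c

variable (u : D ⥤ C)

/-- The restriction functor `u^*` of presheaves. -/
abbrev pull : (Cᵒᵖ ⥤ Type u) ⥤ Dᵒᵖ ⥤ Type u := (Functor.whiskeringLeft _ _ _).obj u.op

/-- The adjunction of `u_!` (left Kan extension) and `u^*`. -/
noncomputable abbrev shriekAdj : u.op.lan ⊣ pull u := u.op.lanAdjunction (Type u)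

/-- The functor `u_*`, with `(u_* X) c = Hom (u^* (y c), X)`. -/
def push : (Dᵒᵖ ⥤ Type u) ⥤ Cᵒᵖ ⥤ Type u :=
  yoneda ⋙ (Functor.whiskeringLeft _ _ _).obj (yoneda ⋙ pull u).op

variable {u}

/-- The adjunction of `u^*` and `u_*`, on hom-sets. -/
def pushEquiv (X : Cᵒᵖ ⥤ Type u) (Y : Dᵒᵖ ⥤ Type u) :
    ((pull u).obj X ⟶ Y) ≃ (X ⟶ (push u).obj Y) where
  toFun f :=
    { app := fun c => TypeCat.ofHom fun x => (pull u).map (yonedaEquiv.symm x) ≫ f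
      naturality := fun c c' i => by
        refine ConcreteCategory.hom_ext _ _ fun x => ?_
        change (pull u).map (yonedaEquiv.symm (X.map i x)) ≫ f =
          (pull u).map (yoneda.map i.unop) ≫ (pull u).map (yonedaEquiv.symm x) ≫ f
        rw [← Category.assoc, ← Functor.map_comp, yonedaEquiv_symm_map] }
  invFun g :=
    { app := fun d => TypeCat.ofHom fun x =>
        NatTrans.app (show (pull u).obj (yoneda.obj (u.obj d.unop)) ⟶ Y from
          g.app (op (u.obj d.unop)) x) d (𝟙 (u.obj d.unop))
      naturality := fun d d' i => by
        refine ConcreteCategory.hom_ext _ _ fun x => ?_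
        have h := NatTrans.naturality_apply g (u.map i.unop).op x
        have h' := NatTrans.naturality_apply (show (pull u).obj (yoneda.obj (u.obj d.unop)) ⟶ Y from
          g.app (op (u.obj d.unop)) x) i (𝟙 (u.obj d.unop))
        refine Eq.trans ?_ h'
        refine (congrArg (fun (k : (pull u).obj (yoneda.obj (u.obj d'.unop)) ⟶ Y) =>
          k.app d' (𝟙 (u.obj d'.unop))) h).trans ?_
        change NatTrans.app (show (pull u).obj (yoneda.obj (u.obj d.unop)) ⟶ Y from
          g.app (op (u.obj d.unop)) x) d' (𝟙 _ ≫ u.map i.unop) = NatTrans.app (show (pull u).obj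
          (yoneda.obj (u.obj d.unop)) ⟶ Y from g.app (op (u.obj d.unop)) x) d' (u.map i.unop ≫ 𝟙 _)
        rw [Category.id_comp, Category.comp_id] }
  left_inv f := by
    refine NatTrans.ext (funext fun d => ConcreteCategory.hom_ext _ _ fun x => ?_)
    change f.app d (X.map (𝟙 _) x) = _
    rw [X.map_id]
    rfl
  right_inv g := by
    refine NatTrans.ext (funext fun c => ConcreteCategory.hom_ext _ _ fun x => ?_)
    refine NatTrans.ext (funext fun d => ConcreteCategory.hom_ext _ _ fun i => ?_)
    have h := NatTrans.naturality_apply g (Quiver.Hom.op (show u.obj d.unop ⟶ c.unop from i)) x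
    refine (congrArg (fun (k : (pull u).obj (yoneda.obj (u.obj d.unop)) ⟶ Y) =>
      k.app d (𝟙 (u.obj d.unop))) h).trans ?_
    change NatTrans.app (show (pull u).obj (yoneda.obj c.unop) ⟶ Y from g.app c x) d (𝟙 _ ≫ _) = _
    rw [Category.id_comp]
    rfl

variable (u)

/-- The adjunction of `u^*` and `u_*`. -/
def pushAdj : pull u ⊣ push u :=
  Adjunction.mkOfHomEquiv
    { homEquiv := pushEquiv
      homEquiv_naturality_left_symm := fun _ _ => rfl
      homEquiv_naturality_right := fun f g => by
        refine NatTrans.ext (funext fun c => ConcreteCategory.hom_ext _ _ fun x => ?_)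
        exact (Category.assoc ((pull u).map (yonedaEquiv.symm x)) f g).symm }

/-- The monad `T_D`: the transport of `T` along the adjunction of `u_!` and `u^*`, with functor part
`u^* T u_!`. -/
noncomputable def restrictMonad (T : Monad (Cᵒᵖ ⥤ Type u)) : Monad (Dᵒᵖ ⥤ Type u) :=
  transport (shriekAdj u) T

/-- `T` is `D`-graded for the restriction of cell shapes `u`. When `T` is familial, with arities
`T[t]`, the condition `isIso` says that for all `X`, every map `T[t] ⟶ X` for an operation `t` over
an object of `D` factors uniquely through `u_! u^* X ⟶ X`; that is, that each of these `T[t]` is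
isomorphic to a presheaf of the form `u_! Y`. -/
structure IsGraded (T : Monad (Cᵒᵖ ⥤ Type u)) : Prop where
  restriction : IsRestriction u
  isIso : ∀ X, IsIso ((pull u).map (T.map ((shriekAdj u).counit.app X)))

variable {u} {T : Monad (Cᵒᵖ ⥤ Type u)}

/-- The lift of `u_*` to a functor from `T_D`-algebras to `T`-algebras. -/
noncomputable def pushAlgebra (h : IsGraded u T) : (restrictMonad u T).Algebra ⥤ T.Algebra :=
  pushAlgFunctor (shriekAdj u) (pushAdj u) h.isIso

/-- A `(V, D)`-enriched `T`-algebra: a `T_D`-algebra `A` with a `T`-multifunctor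
`M u_* A ⟶ V`. -/
structure EnrichedAlgebra (h : IsGraded u T) (V : Multicat T) where
  alg : (restrictMonad u T).Algebra
  hom : (discrete T).obj ((pushAlgebra h).obj alg) ⟶ V

end Restriction

section Enriched

variable {C : Type u} [SmallCategory C] (T : FamilialMonad C)

namespace FamilialMonad

theorem incl_isRestriction : IsRestriction T.incl where
  full := ⟨fun f => match f with | .cell i => ⟨i, rfl⟩⟩
  faithful := ⟨fun h => PlusHom.cell.inj h⟩
  injective _ _ h := Plus.cell.inj h
  downward {c _} f := match c, f with | .cell c, _ => ⟨c, rfl⟩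

theorem plus_map_cells {X Y : T.Plusᵒᵖ ⥤ Type u} (f : X ⟶ Y) :
    (pull T.incl).map (T.plus.map f) = (pull T.incl).map f := by
  refine NatTrans.ext (funext fun c => ConcreteCategory.hom_ext _ _ fun x => ?_)
  rfl

theorem incl_isGraded : IsGraded T.incl T.plus where
  restriction := T.incl_isRestriction
  isIso X := by
    rw [plus_map_cells]
    have := T.incl_isRestriction.full
    have := T.incl_isRestriction.faithful
    have h : IsIso ((T.incl.op.lanUnit (H := Type u)).app (T.incl.op ⋙ X)) := inferInstance
    have e := T.incl.op.lanUnit_app_whiskerLeft_lanAdjunction_counit_app X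
    exact @IsIso.of_isIso_fac_left _ _ _ _ _ _ _ _ h (inferInstanceAs (IsIso (𝟙 _))) e

/-- The indiscrete `T`-multicategory on a presheaf, as a `T⁺`-algebra. -/
noncomputable def indiscretePlus : (Cᵒᵖ ⥤ Type u) ⥤ T.plus.Algebra :=
  indiscrete T.monad ⋙ Monad.comparison T.freeAdj

/-- For a `T⁺`-multicategory `V`, a `V`-enriched `T`-multicategory in the sense of Leinster: a
presheaf `A` on `C` with a `T⁺`-multifunctor to `V` from `M` of the indiscrete `T`-multicategory on
`A`. -/
structure LeinsterEnriched (V : Multicat T.plus) where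
  obj : Cᵒᵖ ⥤ Type u
  hom : (discrete T.plus).obj (T.indiscretePlus.obj obj) ⟶ V

end FamilialMonad
end Enriched

end EnrichedAlgebras

open EnrichedAlgebras

/-!
The functor `T⁺` and its unit do nothing to the cells of a presheaf on `C⁺`: the free
`T`-multicategory on `X` has the cells of `X` (`isIso_plus_unit_cells`). Two things follow formally.

* The monad `(T⁺)_C` has an invertible unit, being the transport of `T⁺` along the adjunction of the
  fully faithful `u_!` with `u^*`. So each presheaf on `C` is an algebra in exactly one way
  (`algebraOfIsIsoUnit`, `algebra_ext_of_isIso_unit`).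
* A map into `u_* A` is determined by its transpose, which only sees cells, so any map from a
  `T⁺`-algebra into `u_* A` is automatically a homomorphism (`comp_pushAlg_a`).

The cells of `Ind A` form the presheaf `A`, so the identity of `A` has a transpose
`indToPush : Ind A ⟶ u_* A`, natural in `A`. It is bijective (`isIso_indToPush`): a `t`-arrow on
either side is a map from the arity of `t` to `A` together with a cell of `A` of the output shape.
By the second point it is an isomorphism of `T⁺`-algebras, and its inverse is the isomorphism sought;
by the first point, enriched algebras correspond to Leinster's enriched multicategories.
-/

namespace EnrichedAlgebras

section UniqueAlgebras

variable {E : Type*} [Category* E] (T : Monad E) [∀ X, IsIso (T.η.app X)]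

/-- On every object, a monad with invertible unit has an algebra structure, necessarily the inverse
of the unit. -/
noncomputable def algebraOfIsIsoUnit (A : E) : T.Algebra where
  A := A
  a := inv (T.η.app A)
  unit := IsIso.hom_inv_id _
  assoc := by
    -- both `μ` and `T (η⁻¹)` are inverse to `T η`
    congr 1
    rw [← cancel_epi (T.map (T.η.app A)), ← T.map_comp, IsIso.hom_inv_id, T.map_id]
    exact T.right_unit A

theorem algebra_ext_of_isIso_unit {B B' : T.Algebra} (h : B.A = B'.A) : B = B' := by
  obtain ⟨A, a, ha, _⟩ := B
  obtain ⟨A', a', ha', _⟩ := B'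
  obtain rfl : A = A' := h
  obtain rfl : a = a' :=
    (IsIso.eq_inv_of_hom_inv_id ha).trans (IsIso.eq_inv_of_hom_inv_id ha').symm
  rfl

end UniqueAlgebras

section Transport

variable {E F : Type*} [Category* E] [Category* F] {L : F ⥤ E} {R : E ⥤ F} {S : F ⥤ E}
  (adj : L ⊣ R) (adj' : R ⊣ S) {T : Monad E}

/-- The unit of the transport is the composite of the unit of `adj` with `R` of the unit of `T`. -/
theorem isIso_transport_unit (Z : F) (hZ : IsIso (adj.unit.app Z))
    (h : ∀ X, IsIso (R.map (T.η.app X))) : IsIso ((transport adj T).η.app Z) := by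
  have h₀ : T.adj.unit.app (L.obj Z) = T.η.app (L.obj Z) := by
    simp only [Monad.adj, Adjunction.mkOfHomEquiv_unit_app]
    exact Category.comp_id _
  change IsIso ((adj.comp T.adj).unit.app Z)
  rw [Adjunction.comp_unit_app, h₀]
  exact @IsIso.comp_isIso _ _ _ _ _ _ _ hZ (h (L.obj Z))

variable (hT : ∀ X, IsIso (transportMap adj T X))

theorem map_unit_pushPre (Y : (transport adj T).Algebra) :
    R.map (T.η.app (S.obj Y.A)) ≫ pushPre adj adj' hT Y = adj'.counit.app Y.A := by
  rw [← transportMap_eta adj T, Category.assoc, map_pushPre]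
  have h := (transport adj T).η.naturality (adj'.counit.app Y.A)
  dsimp at h
  rw [← reassoc_of% h, Y.unit, Category.comp_id]

/-- If `R` inverts the unit of `T`, every map from a `T`-algebra to `S Y` is a homomorphism: the
transposes of two maps `T X ⟶ S Y` are maps `R T X ⟶ Y`, which agree if they agree after
composition with `R X ⟶ R T X`. -/
theorem comp_pushAlg_a (h : ∀ X, IsIso (R.map (T.η.app X))) (X : T.Algebra)
    (Y : (transport adj T).Algebra) (f : X.A ⟶ S.obj Y.A) :
    T.map f ≫ (pushAlg adj adj' hT Y).a = X.a ≫ f := by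
  apply (adj'.homEquiv _ _).symm.injective
  have := h X.A
  rw [← cancel_epi (R.map (T.η.app X.A))]
  change _ ≫ (adj'.homEquiv _ _).symm (T.map f ≫ adj'.homEquiv _ _ (pushPre adj adj' hT Y)) = _
  rw [Adjunction.homEquiv_naturality_left_symm, Equiv.symm_apply_apply,
    Adjunction.homEquiv_naturality_left_symm, ← R.map_comp_assoc, ← R.map_comp_assoc, X.unit]
  have e := T.η.naturality f
  dsimp at e ⊢
  rw [← e, R.map_comp, Category.assoc, map_unit_pushPre, Adjunction.homEquiv_counit, R.map_id,
    Category.id_comp]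

end Transport

section Elements

variable {C : Type u} [SmallCategory C] {X Y : Cᵒᵖ ⥤ Type u} {c : C}

theorem prod_elt_ext {z z' : (X ⨯ Y).obj (op c)}
    (h₁ : (prod.fst : X ⨯ Y ⟶ X).app _ z = (prod.fst : X ⨯ Y ⟶ X).app _ z')
    (h₂ : (prod.snd : X ⨯ Y ⟶ Y).app _ z = (prod.snd : X ⨯ Y ⟶ Y).app _ z') : z = z' := by
  apply yonedaEquiv.symm.injective
  apply Limits.prod.hom_ext <;> apply yonedaEquiv.injective <;> simpa [yonedaEquiv_comp]

theorem exists_prod_elt (x : X.obj (op c)) (y : Y.obj (op c)) :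
    ∃ z : (X ⨯ Y).obj (op c), (prod.fst : X ⨯ Y ⟶ X).app _ z = x ∧
      (prod.snd : X ⨯ Y ⟶ Y).app _ z = y := by
  refine ⟨yonedaEquiv (prod.lift (yonedaEquiv.symm x) (yonedaEquiv.symm y)), ?_, ?_⟩
  · rw [← yonedaEquiv_comp, prod.lift_fst, Equiv.apply_symm_apply]
  · rw [← yonedaEquiv_comp, prod.lift_snd, Equiv.apply_symm_apply]

end Elements

namespace FamilialMonad

variable {C : Type u} [SmallCategory C] (T : FamilialMonad C)

/-- The unit of `T⁺` is invertible on cells, as the free `T`-multicategory on `X` has the same cells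
as `X`. -/
theorem isIso_plus_unit_cells (X : T.Plusᵒᵖ ⥤ Type u) :
    IsIso ((pull T.incl).map (T.plus.η.app X)) := by
  have h : (pull T.incl).map (T.plus.η.app X) = 𝟙 ((pull T.incl).obj X) := by
    refine NatTrans.ext (funext fun c => ConcreteCategory.hom_ext _ _ fun x => ?_)
    rfl
  rw [h]
  exact inferInstanceAs (IsIso (𝟙 ((pull T.incl).obj X)))

instance (A : Cᵒᵖ ⥤ Type u) : IsIso ((restrictMonad T.incl T.plus).η.app A) := by
  have := T.incl_isRestriction.full
  have := T.incl_isRestriction.faithful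
  exact isIso_transport_unit (shriekAdj T.incl) A
    (inferInstanceAs (IsIso ((T.incl.op.lanUnit (H := Type u)).app A))) T.isIso_plus_unit_cells

/-- The comparison `Ind A ⟶ u_* A`: the transpose of the identity of `A`, which is the presheaf
of cells of `Ind A`. -/
noncomputable def indToPush (A : Cᵒᵖ ⥤ Type u) :
    (T.indiscretePlus.obj A).A ⟶ (push T.incl).obj A :=
  (pushAdj T.incl).homEquiv (T.indiscretePlus.obj A).A A (𝟙 A)

theorem indToPush_counit (A : Cᵒᵖ ⥤ Type u) :
    (pull T.incl).map (T.indToPush A) ≫ (pushAdj T.incl).counit.app A = 𝟙 A :=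
  ((pushAdj T.incl).homEquiv_counit _ _ _).symm.trans (Equiv.symm_apply_apply _ _)

theorem indToPush_naturality {A B : Cᵒᵖ ⥤ Type u} (f : A ⟶ B) :
    (T.indiscretePlus.map f).f ≫ T.indToPush B = T.indToPush A ≫ (push T.incl).map f := by
  refine ((pushAdj T.incl).homEquiv_naturality_left _ _).symm.trans
    (Eq.trans ?_ ((pushAdj T.incl).homEquiv_naturality_right _ _))
  refine congrArg ((pushAdj T.incl).homEquiv (T.indiscretePlus.obj A).A B) ?_
  exact (Category.comp_id f).trans (Category.id_comp f).symm

theorem indToPush_target (A : Cᵒᵖ ⥤ Type u) (t : T.Op)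
    (p : (T.indiscretePlus.obj A).A.obj (op (.arrow t))) {d : C} (i : d ⟶ T.shape t) :
    NatTrans.app (show (pull T.incl).obj (yoneda.obj (.arrow t)) ⟶ A from
      (T.indToPush A).app (op (.arrow t)) p) (op d) (PlusHom.target i) =
      A.map i.op ((prod.snd : T.monad.obj A ⨯ A ⟶ A).app _ p.1.1) :=
  rfl

/-- On cells this is the Yoneda lemma. The arrow shape of an operation `t` restricts to the coproduct
of the representable on the output shape of `t` and the arity of `t`; so a `t`-arrow of `u_* A` is a
cell of `A` of the output shape with a map from the arity to `A`, as is a `t`-arrow of `Ind A`. -/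
theorem isIso_indToPush (A : Cᵒᵖ ⥤ Type u) : IsIso (T.indToPush A) := by
  rw [NatTrans.isIso_iff_isIso_app]
  rintro ⟨c | t⟩ <;> rw [isIso_iff_bijective]
  · refine ⟨fun a b h => ?_, fun (x : (pull T.incl).obj (yoneda.obj (T.incl.obj c)) ⟶ A) => ?_⟩
    · have h' := congrArg (((pushAdj T.incl).counit.app A).app (op c)) h
      exact (app_congr (T.indToPush_counit A) a).symm.trans
        (h'.trans (app_congr (T.indToPush_counit A) b))
    · refine ⟨x.app (op c) (PlusHom.cell (𝟙 c)), ?_⟩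
      refine hom_ext_elt fun d i => ?_
      obtain ⟨i⟩ := i
      refine (nat_apply x i (PlusHom.cell (𝟙 c))).symm.trans ?_
      exact congrArg (fun j => x.app (op d) (PlusHom.cell j)) (Category.comp_id i)
  · constructor
    · intro p q h
      have h' := fun (d : C) (j : T.PlusHom (.cell d) (.arrow t)) =>
        congrArg (fun (x : (pull T.incl).obj (yoneda.obj (Plus.arrow t)) ⟶ A) => x.app (op d) j) h
      have h₂ : p.1.2 = q.1.2 := hom_ext_elt fun d x => h' d (.source x)
      refine Subtype.ext (Prod.ext (prod_elt_ext ?_ ?_) h₂)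
      · exact p.2.trans ((congrArg (T.elt t) h₂).trans q.2.symm)
      · have h₃ := h' _ (.target (𝟙 _))
        dsimp only at h₃
        rw [indToPush_target, indToPush_target] at h₃
        simpa using h₃
    · intro x
      let x : (pull T.incl).obj (yoneda.obj (Plus.arrow t)) ⟶ A := x
      let a : T.arity.obj t ⟶ A :=
        { app := fun d => TypeCat.ofHom fun z => x.app d (PlusHom.source z)
          naturality := fun d e i => ConcreteCategory.hom_ext _ _ fun z =>
            nat_apply x i.unop (PlusHom.source z) }
      obtain ⟨z, h₁, h₂⟩ := exists_prod_elt (T.elt t a)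
        (x.app (op (T.shape t)) (PlusHom.target (𝟙 _)))
      refine ⟨⟨(z, a), h₁⟩, ?_⟩
      refine hom_ext_elt fun d j => ?_
      match j with
      | .source y => rfl
      | .target i =>
        refine (congrArg (A.map i.op) h₂).trans ?_
        refine (nat_apply x i (PlusHom.target (𝟙 _))).symm.trans ?_
        exact congrArg (fun j => x.app (op d) (PlusHom.target j)) (Category.comp_id i)

/-- The comparison is an isomorphism of `T⁺`-algebras, since every map from a `T⁺`-algebra to
`u_* A` is a homomorphism. -/
noncomputable def indPushAlgIso (A : (restrictMonad T.incl T.plus).Algebra) :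
    T.indiscretePlus.obj A.A ≅ (pushAlgebra T.incl_isGraded).obj A :=
  Monad.Algebra.isoMk (@asIso _ _ _ _ (T.indToPush A.A) (T.isIso_indToPush A.A))
    (comp_pushAlg_a (shriekAdj T.incl) (pushAdj T.incl) T.incl_isGraded.isIso
      T.isIso_plus_unit_cells (T.indiscretePlus.obj A.A) A (T.indToPush A.A))

/-- The isomorphism of `u_* A` and `Ind A`, natural in `A`. -/
noncomputable def pushIsoInd :
    pushAlgebra T.incl_isGraded ≅ (restrictMonad T.incl T.plus).forget ⋙ T.indiscretePlus :=
  (NatIso.ofComponents (F := (restrictMonad T.incl T.plus).forget ⋙ T.indiscretePlus)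
    T.indPushAlgIso
    (fun {A B} (f : Monad.Algebra.Hom A B) =>
      Monad.Algebra.Hom.ext (T.indToPush_naturality f.f))).symm

/-- On cells the isomorphism is the counit of `u^* ⊣ u_*`, that is, evaluation at identities. -/
theorem pushIsoInd_cell (A : (restrictMonad T.incl T.plus).Algebra) :
    (pull T.incl).map (T.pushIsoInd.hom.app A).f = (pushAdj T.incl).counit.app A.A := by
  have : IsIso ((pull T.incl).map (T.indToPush A.A)) :=
    @Functor.map_isIso _ _ _ _ _ _ _ _ (T.isIso_indToPush A.A)
  refine (cancel_epi ((pull T.incl).map (T.indToPush A.A))).mp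
    (Eq.trans ?_ (T.indToPush_counit A.A).symm)
  refine ((pull T.incl).map_comp _ _).symm.trans ?_
  refine Eq.trans ?_ ((pull T.incl).map_id _)
  exact congrArg (fun k : Monad.Algebra.Hom _ _ => (pull T.incl).map k.f)
    (T.indPushAlgIso A).hom_inv_id

/-- Transport along the comparison is bijective on multifunctors, and an algebra of the transported
monad amounts to its underlying presheaf. -/
theorem enriched_bijective (V : Multicat T.plus) : Function.Bijective
    (fun E : EnrichedAlgebra T.incl_isGraded V =>
      (⟨E.alg.A, (discrete T.plus).map (T.pushIsoInd.inv.app E.alg) ≫ E.hom⟩ :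
        T.LeinsterEnriched V)) := by
  constructor
  · rintro ⟨B, f⟩ ⟨B', f'⟩ h
    injection h with h₁ h₂
    obtain rfl := algebra_ext_of_isIso_unit _ h₁
    have h₃ := (cancel_epi ((discrete T.plus).mapIso (T.indPushAlgIso B)).hom).mp (eq_of_heq h₂)
    exact congrArg (EnrichedAlgebra.mk B) h₃
  · rintro ⟨A, g⟩
    let B := algebraOfIsIsoUnit (restrictMonad T.incl T.plus) A
    refine ⟨⟨B, (discrete T.plus).map (T.pushIsoInd.hom.app B) ≫ g⟩, ?_⟩
    refine congrArg (LeinsterEnriched.mk A) ?_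
    exact ((discrete T.plus).mapIso (T.indPushAlgIso B)).hom_inv_id_assoc g

end FamilialMonad
end EnrichedAlgebras

theorem mainTheorem8 {C : Type u} [SmallCategory C] (T : FamilialMonad C) :
    ∃ φ : pushAlgebra T.incl_isGraded ≅ (restrictMonad T.incl T.plus).forget ⋙ T.indiscretePlus,
      (∀ (A : (restrictMonad T.incl T.plus).Algebra) (c : C)
        (x : (pull T.incl).obj (yoneda.obj (T.incl.obj c)) ⟶ A.A),
          (φ.hom.app A).f.app (op (T.incl.obj c)) x = x.app (op c) (𝟙 (T.incl.obj c))) ∧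
      (∀ A : Cᵒᵖ ⥤ Type u, ∃! B : (restrictMonad T.incl T.plus).Algebra, B.A = A) ∧
      ∀ V : Multicat T.plus, Function.Bijective
        (fun E : EnrichedAlgebra T.incl_isGraded V =>
          (⟨E.alg.A, (discrete T.plus).map (φ.inv.app E.alg) ≫ E.hom⟩ : T.LeinsterEnriched V)) := by
  refine ⟨T.pushIsoInd, fun A c x => ?_, fun A => ?_, T.enriched_bijective⟩
  · exact app_congr (T.pushIsoInd_cell A) x
  · exact ⟨algebraOfIsIsoUnit _ A, rfl, fun B hB => algebra_ext_of_isIso_unit _ hB⟩
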